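/- **Setting.** Let $K$ be a compact connected metric space with finitely many contractive injections $F_l:K\to K$, $0\le l<N$, such that $K=\bigcup_l F_lK$. For a word $w=w_1\cdots w_m$ put $F_w=F_{w_1}\circ\cdots\circ F_{w_m}$, and for numbers $t_l$ put $t_w=t_{w_1}\cdots t_{w_m}$. Let $V_0\subset K$ be a finite set, each of whose points is a fixed point of some $F_l$, such that $F_wK\cap F_{w'}K\subset F_wV_0\cap F_{w'}V_0$ for different words $w,w'$ of the same length ($K$ is a p.c.f. self-similar set with boundary $V_0$). Put $V_m=\bigcup_{|w|=m}F_wV_0$ and $V_*=\bigcup_m V_m$. Let a regular harmonic structure be given: symmetric conductances $c_{pq}\ge 0$ ($p,q\in V_0$) such that $\mathcal E_0(u,u)=0$ only if $u$ is constant on $V_0$, where $\mathcal E_0(u,v)=\frac12\sum_{p,q\in V_0}c_{pq}(u(p)-u(q))(v(p)-v(q))$, and factors $0<r_l<1$ such that, with $\mathcal E_m(u,v)=\sum_{|w|=m}r_w^{-1}\mathcal E_0(u\circ F_w,v\circ F_w)$, for every $u$ on $V_0$ the minimum of $\mathcal E_1(f,f)$ over all extensions $f$ of $u$ to $V_1$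 equals $\mathcal E_0(u,u)$. Let $\mu$ be a Borel probability measure on $K$ with $\mu(B)=\sum_l\mu_l\,\mu(F_l^{-1}B)$ for all Borel sets $B$, where $\mu_l>0$ and $\sum_l\mu_l=1$. A continuous function $h:K\to\mathbb R$ is harmonic, $h\in\mathcal H_0$, if for each $m\ge0$ it minimizes $\mathcal E_{m+1}(f,f)$ among all $f$ that equal $h$ on $V_m$. For $x\in V_m$ let $\psi^m_x$ be the tent function: the continuous function that equals $1$ at $x$, equals $0$ at the other points of $V_m$, and is such that $\psi^m_x\circ F_w$ is harmonic for every $|w|=m$. For $x\in V_m\setminus V_0$ let $$\tilde\Delta_mf(x)=\Big(\int_K\psi^m_x\,d\mu\Big)^{-1}\ \sum_{|w|=m}\ \sum_{\substack{p,q\in V_0\\ F_wp=x}}r_w^{-1}c_{pq}\,\big(f(F_wq)-f(x)\big).$$ We write $f\in \mathrm{dom}\,\Delta_\mu$ and $\Delta_\mu f=g$ if $f,g:K\to\mathbb R$ are continuous and $\sup_{x\in V_m\setminus V_0}|\tilde\Delta_mf(x)-g(x)|\to0$ as $m\to\infty$. **Theorem 5.2 (Calculation of $\Delta_\mu$).**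 Let $n\in\mathbb N$, $y_1,\dots,y_n\in V_*$, $a_1,\dots,a_n\in\mathbb R$ and $A\ne0$ be such that $$\sum_{j=1}^n a_jh(y_j)=0\ \text{ for all } h\in\mathcal H_0,\qquad \sum_{j=1}^n a_jh'(y_j)=A\ \text{ for all } h' \text{ with } \Delta_\mu h'=1 .$$ Then for every $f\in\mathrm{dom}\,\Delta_\mu$ $$\Delta_\mu f(x)=\lim_{m\to\infty}A^{-1}\big(r_{[w]_m}\mu_{[w]_m}\big)^{-1}\sum_{j=1}^n a_jf\big(F_{[w]_m}y_j\big)$$ uniformly in $x\in K$ and in the infinite words $w$ corresponding to $x$, that is, those with $x\in F_{[w]_m}K$ for all $m$, where $[w]_m$ is the word of the first $m$ letters of $w$. -/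

import Mathlib

open MeasureTheory Filter Topology

noncomputable section

/-- A post critically finite self-similar structure on a compact connected metric space `K`
(compactness and connectedness are imposed on `K` as type classes): finitely many contractive
injections `F l` with `K = ⋃ F l K`, and a finite boundary set `V0`, each of whose points is the
fixed point of one of the maps, such that different cells of equal level meet only in images of
boundary points.  Here `K` is the invariant set itself. -/
structure PCFSystem (K : Type*) [MetricSpace K] (N : ℕ) where
  /-- the contractions -/
  F : Fin N → K → K
  /-- the boundary -/
  V0 : Finset K
  contracting : ∀ l, ∃ k : NNReal, ContractingWith k (F l)
  injective : ∀ l, Function.Injective (F l)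
  cover : (⋃ l, Set.range (F l)) = Set.univ
  boundary_fixed : ∀ q ∈ V0, ∃ l, F l q = q
  /-- Different cells of equal level meet only in images of boundary points.  For a word
  `w = w₁ ⋯ wₘ` the map in the statement is `F w₁ ∘ ⋯ ∘ F wₘ`. -/
  cell_inter : ∀ (m : ℕ) (w w' : Fin m → Fin N), w ≠ w' →
    Set.range ((List.ofFn fun i => F (w i)).foldr (· ∘ ·) id) ∩
        Set.range ((List.ofFn fun i => F (w' i)).foldr (· ∘ ·) id) ⊆
      (((List.ofFn fun i => F (w i)).foldr (· ∘ ·) id) '' V0) ∩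
        (((List.ofFn fun i => F (w' i)).foldr (· ∘ ·) id) '' V0)

namespace PCFSystem

variable {K : Type*} [MetricSpace K] {N : ℕ} (S : PCFSystem K N)

/-- `F_w = F w₁ ∘ ⋯ ∘ F wₘ` for a word `w` of length `m`. -/
def cellMap {m : ℕ} (w : Fin m → Fin N) : K → K :=
  (List.ofFn fun i => S.F (w i)).foldr (· ∘ ·) id

theorem cellMap_zero (w : Fin 0 → Fin N) : S.cellMap w = id := by
  simp [cellMap]

theorem cellMap_succ {m : ℕ} (w : Fin (m + 1) → Fin N) :
    S.cellMap w = S.F (w 0) ∘ S.cellMap (fun i : Fin m => w i.succ) := by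
  simp [cellMap, List.ofFn_succ]

/-- The vertices of level `m`. -/
def V (m : ℕ) : Set K := ⋃ w : Fin m → Fin N, S.cellMap w '' S.V0

/-- All vertices. -/
def Vstar : Set K := ⋃ m, S.V m

/-- The truncation `[w]ₘ` of an infinite word to its first `m` letters. -/
def trunc (w : ℕ → Fin N) (m : ℕ) : Fin m → Fin N := fun i => w i

/-- The infinite word `w` corresponds to the point `x`: for every `m`, `x` lies in the cell of
the word `[w]ₘ`. -/
def IsAddress (w : ℕ → Fin N) (x : K) : Prop :=
  ∀ m, x ∈ Set.range (S.cellMap (trunc w m))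

/-- The product `t_w = t_{w₁} ⋯ t_{wₘ}`. -/
def wordProd (t : Fin N → ℝ) {m : ℕ} (w : Fin m → Fin N) : ℝ := ∏ i, t (w i)

/-- The energy on the complete graph over `V0` with conductances `c`; every unordered pair
occurs twice in the double sum, hence the factor `1 / 2`. -/
def energy0 (c : K → K → ℝ) (f g : K → ℝ) : ℝ :=
  (1 / 2) * ∑ p ∈ S.V0, ∑ q ∈ S.V0, c p q * (f p - f q) * (g p - g q)

/-- The renormalized graph energy of level `m`: the edge joining `F_w p` and `F_w q` carries the
conductance `r_w⁻¹ c p q`. -/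
def energy (c : K → K → ℝ) (r : Fin N → ℝ) (m : ℕ) (f g : K → ℝ) : ℝ :=
  ∑ w : Fin m → Fin N,
    (wordProd r w)⁻¹ * S.energy0 c (f ∘ S.cellMap w) (g ∘ S.cellMap w)

/-- A regular harmonic structure: conductances on `V0` whose energy vanishes only on constants,
and renormalization factors in `(0, 1)`, such that the restriction of the level one energy to
`V0` (its minimum over all extensions) is the level zero energy.  The analogous
statement from level `m` to level `m - 1` follows cell by cell.
Only the values of `c` at pairs of points of `V0` matter. -/
structure RegularHarmonicStructure where
  /-- the conductances of level zero -/
  c : K → K → ℝ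
  /-- the renormalization factors -/
  r : Fin N → ℝ
  c_symm : ∀ p ∈ S.V0, ∀ q ∈ S.V0, c p q = c q p
  c_nonneg : ∀ p ∈ S.V0, ∀ q ∈ S.V0, 0 ≤ c p q
  irreducible : ∀ u : K → ℝ, S.energy0 c u u = 0 → ∀ p ∈ S.V0, ∀ q ∈ S.V0, u p = u q
  r_pos : ∀ l, 0 < r l
  r_lt_one : ∀ l, r l < 1
  restriction : ∀ u : K → ℝ,
    IsLeast {e : ℝ | ∃ f : K → ℝ, (∀ p ∈ S.V0, f p = u p) ∧ e = S.energy c r 1 f f}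
      (S.energy0 c u u)

/-- `μ` is the self-similar probability measure with the positive probability weights `t`. -/
structure IsSelfSimilarMeasure [MeasurableSpace K] (t : Fin N → ℝ) (μ : Measure K) : Prop where
  weight_pos : ∀ l, 0 < t l
  weight_sum : ∑ l, t l = 1
  prob : IsProbabilityMeasure μ
  self_similar : ∀ A : Set K, MeasurableSet A →
    μ A = ∑ l, ENNReal.ofReal (t l) * μ (S.F l ⁻¹' A)

namespace RegularHarmonicStructure

variable {S} (H : S.RegularHarmonicStructure)

/-- A harmonic function on `K`: it is continuous and minimizes the energy from level `m` to level
`m + 1` for each `m`. -/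
def IsHarmonic (h : K → ℝ) : Prop :=
  Continuous h ∧ ∀ (m : ℕ) (f : K → ℝ), (∀ x ∈ S.V m, f x = h x) →
    S.energy H.c H.r (m + 1) h h ≤ S.energy H.c H.r (m + 1) f f

/-- `ψ` is the tent function of level `m` at the vertex `x`: it is harmonic on each cell of
level `m`, equal to `1` at `x` and to `0` at the other vertices of level `m`. -/
def IsTent (m : ℕ) (x : K) (ψ : K → ℝ) : Prop :=
  Continuous ψ ∧ (∀ w : Fin m → Fin N, H.IsHarmonic (ψ ∘ S.cellMap w)) ∧
    ψ x = 1 ∧ ∀ y ∈ S.V m, y ≠ x → ψ y = 0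

open Classical in
/-- The graph Laplacian of level `m`: the sum of `c_{xy} (f y - f x)` over the neighbours `y` of
`x`, where the edges at `x` are those joining `x = F_w p` to `F_w q`, with conductance
`r_w⁻¹ c p q`. -/
def graphLaplacian (m : ℕ) (f : K → ℝ) (x : K) : ℝ :=
  ∑ w : Fin m → Fin N, ∑ p ∈ S.V0, ∑ q ∈ S.V0,
    if S.cellMap w p = x then (wordProd H.r w)⁻¹ * H.c p q * (f (S.cellMap w q) - f x) else 0

/-- `f` is in the domain of the Laplacian with respect to `μ`, with Laplacian `g`: both functions
are continuous, and the graph Laplacians of `f`, divided by the integrals of the tent functions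
`ψ m x`, converge to `g` uniformly on the vertices outside `V0` (the function of level `m` being
defined at the vertices of level `m`). -/
def HasLaplacian [MeasurableSpace K] (μ : Measure K) (f g : K → ℝ) : Prop :=
  Continuous f ∧ Continuous g ∧
    ∃ ψ : ℕ → K → K → ℝ, (∀ m, ∀ x ∈ S.V m \ S.V0, H.IsTent m x (ψ m x)) ∧
      ∀ ε > 0, ∃ M : ℕ, ∀ m ≥ M, ∀ x ∈ S.V m \ S.V0,
        |(∫ z, ψ m x z ∂μ)⁻¹ * H.graphLaplacian m f x - g x| < ε

end RegularHarmonicStructure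

end PCFSystem

end

noncomputable section

namespace PCFSystem

/-! On a small cell `f` is, after rescaling, close to a harmonic function plus a multiple of a
function with Laplacian 1. For a word `w` of length `m` put `κ = r_w μ_w`. Then `f ∘ F_w` has
Laplacian `κ (g ∘ F_w)` (`HasLaplacian.comp_cellMap`). Let `h` be harmonic with the boundary values
of `f ∘ F_w`, and let `η` have Laplacian 1 and vanish on `V0`. The remainder `u = f ∘ F_w - h - κ
g(x) η` vanishes on `V0` and has Laplacian `κ (g ∘ F_w - g(x))`, which is small compared with `κ`,
uniformly in the cell, because `g` is uniformly continuous. The maximum principle bounds `u` by a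
small multiple of `κ sup |η|` (`HasLaplacian.abs_le_mul`). The functional with weights `a j`
annihilates `h` and takes the value `A` at `η`; dividing by `A κ` gives the limit.

The substance lies in the existence of `h` (`exists_isCellExtremal`) and `η`
(`exists_weak_potential`). Both solve self-similar functional equations, obtained by a geometrically
convergent iteration of gluings (`exists_selfSimilar_family`). Harmonicity is handled as a linear
condition, extremality on every cell (`isHarmonic_iff_isCellExtremal`), and uniqueness comes from
the connectedness of `K` (`eq_zero_of_energy_one_eq_zero`). -/

/-! ### Words -/

theorem sum_words_succ {N m : ℕ} {M : Type*} [AddCommMonoid M] (φ : (Fin (m + 1) → Fin N) → M) :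
    ∑ w, φ w = ∑ l, ∑ w : Fin m → Fin N, φ (Fin.cons l w) := by
  rw [← (Fin.consEquiv fun _ : Fin (m + 1) => Fin N).sum_comp, Fintype.sum_prod_type]
  rfl

theorem wordProd_cons {N m : ℕ} (t : Fin N → ℝ) (l : Fin N) (w : Fin m → Fin N) :
    wordProd t (Fin.cons l w : Fin (m + 1) → Fin N) = t l * wordProd t w := by
  simp [wordProd, Fin.prod_univ_succ]

theorem wordProd_pos {N m : ℕ} {t : Fin N → ℝ} (ht : ∀ l, 0 < t l) (w : Fin m → Fin N) :
    0 < wordProd t w :=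
  Finset.prod_pos fun i _ => ht (w i)

/-- The supremum is taken in `NNReal`, where the empty supremum is 0, so `N = 0` needs no separate
case. -/
theorem exists_uniform_bound_lt_one {N : ℕ} (k : Fin N → ℝ) (hk : ∀ l, k l < 1) :
    ∃ ρ : ℝ, 0 ≤ ρ ∧ ρ < 1 ∧ ∀ l, k l ≤ ρ := by
  refine ⟨((Finset.univ.sup fun l => (k l).toNNReal : NNReal) : ℝ), NNReal.coe_nonneg _, ?_, ?_⟩
  · rw [← NNReal.coe_one, NNReal.coe_lt_coe, Finset.sup_lt_iff (by simp)]
    intro l _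
    simpa using hk l
  · intro l
    refine (Real.le_coe_toNNReal (k l)).trans ?_
    exact_mod_cast Finset.le_sup (f := fun l => (k l).toNNReal) (Finset.mem_univ l)

/-! ### Cells, vertices and gluing -/

section Cells

variable {K : Type*} [MetricSpace K] {N : ℕ} (S : PCFSystem K N)

theorem cellMap_cons {m : ℕ} (l : Fin N) (w : Fin m → Fin N) :
    S.cellMap (Fin.cons l w : Fin (m + 1) → Fin N) = S.F l ∘ S.cellMap w := by
  rw [cellMap_succ]
  simp

theorem comp_cellMap_cons {m : ℕ} (f : K → ℝ) (l : Fin N) (w : Fin m → Fin N) :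
    f ∘ S.cellMap (Fin.cons l w : Fin (m + 1) → Fin N) = (f ∘ S.F l) ∘ S.cellMap w := by
  rw [cellMap_cons, Function.comp_assoc]

theorem continuous_F (l : Fin N) : Continuous (S.F l) := by
  obtain ⟨k, hk⟩ := S.contracting l
  exact hk.2.continuous

theorem continuous_cellMap {m : ℕ} (w : Fin m → Fin N) : Continuous (S.cellMap w) := by
  induction m with
  | zero => rw [cellMap_zero]; exact continuous_id
  | succ m ih => rw [cellMap_succ]; exact (S.continuous_F _).comp (ih _)

/-- The form in which the intersection condition enters all later arguments. Words of length one
suffice because every induction on levels peels off the first letter. -/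
theorem mem_boundary_of_F_eq {l l' : Fin N} (hl : l ≠ l') {z z' : K} (e : S.F l z = S.F l' z') :
    z ∈ S.V0 ∧ z' ∈ S.V0 := by
  have h := S.cell_inter 1 (fun _ => l) (fun _ => l') (fun h => hl (congrFun h 0))
  simp only [List.ofFn_succ, List.ofFn_zero, List.foldr_cons, List.foldr_nil,
    Function.comp_id] at h
  obtain ⟨⟨p, hp, hpz⟩, q, hq, hqz⟩ := h ⟨⟨z, rfl⟩, ⟨z', e.symm⟩⟩
  have h1 := S.injective l hpz
  have h2 := S.injective l' (hqz.trans e)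
  subst h1 h2
  exact ⟨hp, hq⟩

theorem V_zero : S.V 0 = S.V0 := by
  simp only [V, cellMap_zero, Set.image_id]
  exact Set.iUnion_const _

theorem mem_V_succ {m : ℕ} {x : K} : x ∈ S.V (m + 1) ↔ ∃ l, ∃ z ∈ S.V m, S.F l z = x := by
  simp only [V, Set.mem_iUnion, Set.mem_image]
  constructor
  · rintro ⟨w, p, hp, rfl⟩
    refine ⟨w 0, _, ⟨fun i => w i.succ, p, hp, rfl⟩, ?_⟩
    rw [cellMap_succ]
    rfl
  · rintro ⟨l, z, ⟨w, p, hp, rfl⟩, rfl⟩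
    exact ⟨Fin.cons l w, p, hp, by rw [cellMap_cons]; rfl⟩

theorem F_mem_V_succ {m : ℕ} {z : K} (hz : z ∈ S.V m) (l : Fin N) : S.F l z ∈ S.V (m + 1) :=
  S.mem_V_succ.2 ⟨l, z, hz, rfl⟩

theorem cellMap_mem_V {m : ℕ} (w : Fin m → Fin N) {p : K} (hp : p ∈ S.V0) :
    S.cellMap w p ∈ S.V m :=
  Set.mem_iUnion.2 ⟨w, p, hp, rfl⟩

theorem boundary_subset_V (m : ℕ) {p : K} (hp : p ∈ S.V0) : p ∈ S.V m := by
  induction m with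
  | zero => rw [V_zero]; exact hp
  | succ m ih =>
    obtain ⟨l, hl⟩ := S.boundary_fixed p hp
    exact S.mem_V_succ.2 ⟨l, p, ih, hl⟩

theorem finite_V (m : ℕ) : (S.V m).Finite :=
  Set.finite_iUnion fun _ => S.V0.finite_toSet.image _

theorem exists_F_eq (x : K) : ∃ l z, S.F l z = x := by
  have : x ∈ ⋃ l, Set.range (S.F l) := by rw [S.cover]; trivial
  obtain ⟨l, z, hz⟩ := Set.mem_iUnion.1 this
  exact ⟨l, z, hz⟩

theorem exists_cellMap_eq (m : ℕ) (x : K) : ∃ (w : Fin m → Fin N) (z : K), S.cellMap w z = x := by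
  induction m generalizing x with
  | zero => exact ⟨Fin.elim0, x, by rw [cellMap_zero]; rfl⟩
  | succ m ih =>
    obtain ⟨l, z, rfl⟩ := S.exists_F_eq x
    obtain ⟨w, z, rfl⟩ := ih z
    exact ⟨Fin.cons l w, z, by rw [cellMap_cons]; rfl⟩

/-- A boundary point is fixed by some `F l'`. If `l' = l`, injectivity gives `F l z = z`; otherwise
`F l z` lies in two cells, which forces `z` into the boundary. -/
theorem F_notMem_boundary {z : K} (hz : z ∉ S.V0) (l : Fin N) : S.F l z ∉ S.V0 := by
  intro h
  obtain ⟨l', hl'⟩ := S.boundary_fixed _ h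
  by_cases e : l' = l
  · subst e
    exact hz (by rwa [S.injective _ hl'] at h)
  · exact hz (S.mem_boundary_of_F_eq (Ne.symm e) hl'.symm).1

theorem exists_dist_cellMap_le : ∃ ρ : ℝ, 0 ≤ ρ ∧ ρ < 1 ∧
    ∀ (m : ℕ) (w : Fin m → Fin N) (x y : K),
      dist (S.cellMap w x) (S.cellMap w y) ≤ ρ ^ m * dist x y := by
  choose k hk using S.contracting
  obtain ⟨ρ, h0, h1, hρ⟩ := exists_uniform_bound_lt_one (fun l => (k l : ℝ))
    fun l => by exact_mod_cast (hk l).1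
  refine ⟨ρ, h0, h1, fun m => ?_⟩
  induction m with
  | zero => intro w x y; simp [cellMap_zero]
  | succ m ih =>
    intro w x y
    rw [cellMap_succ]
    refine ((hk (w 0)).2.dist_le_mul _ _).trans ?_
    rw [pow_succ', mul_assoc]
    exact mul_le_mul (hρ _) (ih _ _ _) dist_nonneg h0

theorem exists_level_dist_lt [CompactSpace K] {ε : ℝ} (hε : 0 < ε) :
    ∃ M : ℕ, ∀ m ≥ M, ∀ (w : Fin m → Fin N) (x y : K),
      dist (S.cellMap w x) (S.cellMap w y) < ε := by
  obtain ⟨ρ, h0, h1, hρ⟩ := S.exists_dist_cellMap_le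
  have hlim : Tendsto (fun m => ρ ^ m * Metric.diam (Set.univ : Set K)) atTop (𝓝 0) := by
    simpa using (tendsto_pow_atTop_nhds_zero_of_lt_one h0 h1).mul_const
      (Metric.diam (Set.univ : Set K))
  obtain ⟨M, hM⟩ := eventually_atTop.1 (hlim.eventually (gt_mem_nhds hε))
  refine ⟨M, fun m hm w x y => ((hρ m w x y).trans ?_).trans_lt (hM m hm)⟩
  exact mul_le_mul_of_nonneg_left
    (Metric.dist_le_diam_of_mem isCompact_univ.isBounded trivial trivial) (pow_nonneg h0 m)

theorem dense_Vstar [CompactSpace K] (hne : S.V0.Nonempty) : Dense S.Vstar := by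
  rw [Metric.dense_iff]
  intro x ε hε
  obtain ⟨M, hM⟩ := S.exists_level_dist_lt hε
  obtain ⟨w, z, rfl⟩ := S.exists_cellMap_eq M x
  obtain ⟨p, hp⟩ := hne
  exact ⟨S.cellMap w p, hM M le_rfl w p z, Set.mem_iUnion.2 ⟨M, S.cellMap_mem_V w hp⟩⟩

/-- An inequality between continuous functions that holds at all vertices holds everywhere. -/
theorem le_of_le_on_V [CompactSpace K] (hne : S.V0.Nonempty) {f g : K → ℝ} (hf : Continuous f)
    (hg : Continuous g) (h : ∀ m, ∀ x ∈ S.V m, f x ≤ g x) (x : K) : f x ≤ g x := by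
  refine le_on_closure (s := S.Vstar) ?_ hf.continuousOn hg.continuousOn (S.dense_Vstar hne x)
  intro y hy
  obtain ⟨m, hm⟩ := Set.mem_iUnion.1 hy
  exact h m y hm

/-- Continuous functions on the cells of level one that agree at common vertices can be glued. -/
theorem exists_glue [CompactSpace K] (φ : Fin N → C(K, ℝ)) (B : K → ℝ)
    (h : ∀ l, ∀ p ∈ S.V0, φ l p = B (S.F l p)) :
    ∃ G : C(K, ℝ), ∀ l z, G (S.F l z) = φ l z := by
  -- By compactness `K` is a quotient of the disjoint union of `N` copies of itself, and gluing is
  -- descent along the quotient map.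
  let π : C((_ : Fin N) × K, K) := ⟨fun s => S.F s.1 s.2, continuous_sigma fun l => S.continuous_F l⟩
  have hsurj : Function.Surjective π := fun x => by
    obtain ⟨l, z, h⟩ := S.exists_F_eq x
    exact ⟨⟨l, z⟩, h⟩
  have hq : IsQuotientMap π := IsQuotientMap.of_surjective_continuous hsurj π.continuous
  let Φ : C((_ : Fin N) × K, ℝ) := ⟨fun s => φ s.1 s.2, continuous_sigma fun l => (φ l).continuous⟩
  have hfac : Function.FactorsThrough Φ π := by
    rintro ⟨l, z⟩ ⟨l', z'⟩ (e : S.F l z = S.F l' z')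
    change φ l z = φ l' z'
    by_cases hl : l = l'
    · subst hl
      rw [S.injective l e]
    · obtain ⟨h1, h2⟩ := S.mem_boundary_of_F_eq hl e
      rw [h l z h1, h l' z' h2, e]
  refine ⟨hq.lift Φ hfac, fun l z => ?_⟩
  exact congrArg (fun g => g (⟨l, z⟩ : (_ : Fin N) × K)) (hq.lift_comp Φ hfac)

end Cells

/-! ### Integration against the self-similar measure -/

section Integral

variable {K : Type*} [MetricSpace K] [CompactSpace K] [MeasurableSpace K] [BorelSpace K] {N : ℕ}
  {S : PCFSystem K N} {t : Fin N → ℝ} {μ : Measure K}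

theorem IsSelfSimilarMeasure.integrable (hμ : S.IsSelfSimilarMeasure t μ) {u : K → ℝ}
    (hu : Continuous u) : Integrable u μ := by
  have := hμ.prob
  exact hu.integrable_of_hasCompactSupport (HasCompactSupport.of_compactSpace u)

theorem IsSelfSimilarMeasure.integral_eq_sum (hμ : S.IsSelfSimilarMeasure t μ) {u : K → ℝ}
    (hu : Continuous u) : ∫ z, u z ∂μ = ∑ l, t l * ∫ z, u (S.F l z) ∂μ := by
  have := hμ.prob
  have key : μ = ∑ l, ENNReal.ofReal (t l) • μ.map (S.F l) := by
    ext A hA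
    rw [hμ.self_similar A hA, Measure.finsetSum_apply]
    refine Finset.sum_congr rfl fun l _ => ?_
    rw [Measure.smul_apply, Measure.map_apply (S.continuous_F l).measurable hA, smul_eq_mul]
  conv_lhs => rw [key]
  rw [integral_finsetSum_measure]
  · refine Finset.sum_congr rfl fun l _ => ?_
    rw [integral_smul_measure, ENNReal.toReal_ofReal (hμ.weight_pos l).le, smul_eq_mul,
      integral_map (S.continuous_F l).aemeasurable hu.aestronglyMeasurable]
  · intro l _
    have : IsFiniteMeasure (μ.map (S.F l)) := inferInstance
    exact (hu.integrable_of_hasCompactSupport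
      (HasCompactSupport.of_compactSpace u)).smul_measure ENNReal.ofReal_ne_top

end Integral

/-! ### Bilinearity and self-similarity of the energies -/

section Energy

variable {K : Type*} [MetricSpace K] {N : ℕ} (S : PCFSystem K N)

theorem energy0_congr (c : K → K → ℝ) {f f' g g' : K → ℝ} (hf : ∀ p ∈ S.V0, f p = f' p)
    (hg : ∀ p ∈ S.V0, g p = g' p) : S.energy0 c f g = S.energy0 c f' g' := by
  unfold energy0
  congr 1
  refine Finset.sum_congr rfl fun p hp => Finset.sum_congr rfl fun q hq => ?_
  rw [hf p hp, hf q hq, hg p hp, hg q hq]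

theorem energy0_comm (c : K → K → ℝ) (f g : K → ℝ) : S.energy0 c f g = S.energy0 c g f := by
  unfold energy0
  congr 1
  refine Finset.sum_congr rfl fun p _ => Finset.sum_congr rfl fun q _ => ?_
  ring

theorem energy0_add_left (c : K → K → ℝ) (f f' g : K → ℝ) :
    S.energy0 c (f + f') g = S.energy0 c f g + S.energy0 c f' g := by
  unfold energy0
  rw [← mul_add, ← Finset.sum_add_distrib]
  congr 1
  refine Finset.sum_congr rfl fun p _ => ?_
  rw [← Finset.sum_add_distrib]
  refine Finset.sum_congr rfl fun q _ => ?_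
  simp only [Pi.add_apply]
  ring

theorem energy0_smul_left (c : K → K → ℝ) (s : ℝ) (f g : K → ℝ) :
    S.energy0 c (s • f) g = s * S.energy0 c f g := by
  unfold energy0
  rw [mul_left_comm s]
  congr 1
  rw [Finset.mul_sum]
  refine Finset.sum_congr rfl fun p _ => ?_
  rw [Finset.mul_sum]
  refine Finset.sum_congr rfl fun q _ => ?_
  simp only [Pi.smul_apply, smul_eq_mul]
  ring

theorem energy_comm (c : K → K → ℝ) (r : Fin N → ℝ) (m : ℕ) (f g : K → ℝ) :
    S.energy c r m f g = S.energy c r m g f := by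
  unfold energy
  exact Finset.sum_congr rfl fun w _ => by rw [energy0_comm]

theorem energy_add_left (c : K → K → ℝ) (r : Fin N → ℝ) (m : ℕ) (f f' g : K → ℝ) :
    S.energy c r m (f + f') g = S.energy c r m f g + S.energy c r m f' g := by
  unfold energy
  rw [← Finset.sum_add_distrib]
  refine Finset.sum_congr rfl fun w _ => ?_
  rw [← mul_add, ← energy0_add_left]
  rfl

theorem energy_smul_left (c : K → K → ℝ) (r : Fin N → ℝ) (m : ℕ) (s : ℝ) (f g : K → ℝ) :
    S.energy c r m (s • f) g = s * S.energy c r m f g := by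
  unfold energy
  rw [Finset.mul_sum]
  refine Finset.sum_congr rfl fun w _ => ?_
  rw [mul_left_comm s, ← S.energy0_smul_left c s]
  rfl

theorem energy_add_right (c : K → K → ℝ) (r : Fin N → ℝ) (m : ℕ) (f g g' : K → ℝ) :
    S.energy c r m f (g + g') = S.energy c r m f g + S.energy c r m f g' := by
  simp only [S.energy_comm c r m f, energy_add_left]

theorem energy_smul_right (c : K → K → ℝ) (r : Fin N → ℝ) (m : ℕ) (s : ℝ) (f g : K → ℝ) :
    S.energy c r m f (s • g) = s * S.energy c r m f g := by
  simp only [S.energy_comm c r m f, energy_smul_left]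

theorem energy_zero (c : K → K → ℝ) (r : Fin N → ℝ) (f g : K → ℝ) :
    S.energy c r 0 f g = S.energy0 c f g := by
  simp [energy, cellMap_zero, wordProd]

theorem energy_succ (c : K → K → ℝ) (r : Fin N → ℝ) (m : ℕ) (f g : K → ℝ) :
    S.energy c r (m + 1) f g = ∑ l, (r l)⁻¹ * S.energy c r m (f ∘ S.F l) (g ∘ S.F l) := by
  unfold energy
  rw [sum_words_succ]
  refine Finset.sum_congr rfl fun l _ => ?_
  rw [Finset.mul_sum]
  refine Finset.sum_congr rfl fun w _ => ?_
  rw [wordProd_cons, comp_cellMap_cons, comp_cellMap_cons, mul_inv, mul_assoc]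

theorem energy_add_smul_self (c : K → K → ℝ) (r : Fin N → ℝ) (m : ℕ) (s : ℝ) (f g : K → ℝ) :
    S.energy c r m (f + s • g) (f + s • g) =
      S.energy c r m f f + 2 * s * S.energy c r m f g + s * s * S.energy c r m g g := by
  rw [energy_add_left, energy_add_right, energy_add_right, energy_smul_left, energy_smul_left,
    energy_smul_right, energy_smul_right, S.energy_comm c r m g f]
  ring

theorem energy_one (c : K → K → ℝ) (r : Fin N → ℝ) (f g : K → ℝ) :
    S.energy c r 1 f g = ∑ l, (r l)⁻¹ * S.energy0 c (f ∘ S.F l) (g ∘ S.F l) := by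
  rw [energy_succ]
  simp only [energy_zero]

theorem energy_congr (c : K → K → ℝ) (r : Fin N → ℝ) (m : ℕ) {f f' g g' : K → ℝ}
    (hf : ∀ x ∈ S.V m, f x = f' x) (hg : ∀ x ∈ S.V m, g x = g' x) :
    S.energy c r m f g = S.energy c r m f' g' := by
  unfold energy
  refine Finset.sum_congr rfl fun w _ => ?_
  congr 1
  exact S.energy0_congr c (fun p hp => hf _ (S.cellMap_mem_V w hp))
    (fun p hp => hg _ (S.cellMap_mem_V w hp))

end Energy

/-! ### Energy estimates and extremal extensions to level one -/

namespace RegularHarmonicStructure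

variable {K : Type*} [MetricSpace K] {N : ℕ} {S : PCFSystem K N} (H : S.RegularHarmonicStructure)

theorem energy0_nonneg (f : K → ℝ) : 0 ≤ S.energy0 H.c f f := by
  unfold energy0
  refine mul_nonneg (by norm_num) (Finset.sum_nonneg fun p hp => Finset.sum_nonneg fun q hq => ?_)
  rw [mul_assoc]
  exact mul_nonneg (H.c_nonneg p hp q hq) (mul_self_nonneg _)

theorem edge_le_energy0 (f : K → ℝ) {p q : K} (hp : p ∈ S.V0) (hq : q ∈ S.V0) :
    H.c p q * (f p - f q) ^ 2 ≤ 2 * S.energy0 H.c f f := by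
  have hnn : ∀ p ∈ S.V0, ∀ q ∈ S.V0, 0 ≤ H.c p q * (f p - f q) * (f p - f q) := fun p hp q hq => by
    rw [mul_assoc]
    exact mul_nonneg (H.c_nonneg p hp q hq) (mul_self_nonneg _)
  have h1 := Finset.single_le_sum (f := fun q => H.c p q * (f p - f q) * (f p - f q))
    (fun q hq => hnn p hp q hq) hq
  have h2 := Finset.single_le_sum
    (f := fun p => ∑ q ∈ S.V0, H.c p q * (f p - f q) * (f p - f q))
    (fun p hp => Finset.sum_nonneg fun q hq => hnn p hp q hq) hp
  unfold energy0
  nlinarith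

/-- Differences of boundary values are controlled by the energy. -/
theorem exists_sq_sub_le_energy0_of_mem {p q : K} (hp : p ∈ S.V0) (hq : q ∈ S.V0) :
    ∃ C : ℝ, 0 ≤ C ∧ ∀ f : K → ℝ, (f p - f q) ^ 2 ≤ C * S.energy0 H.c f f := by
  classical
  let R : K → Prop := fun q => ∃ C : ℝ, 0 ≤ C ∧ ∀ f : K → ℝ, (f p - f q) ^ 2 ≤ C * S.energy0 H.c f f
  have hRp : R p := ⟨0, le_rfl, fun f => by simp⟩
  have step : ∀ a ∈ S.V0, ∀ b ∈ S.V0, R a → 0 < H.c a b → R b := by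
    rintro a ha b hb ⟨C, hC, h⟩ hc
    refine ⟨2 * C + 2 * (2 / H.c a b), by positivity, fun f => ?_⟩
    have h1 := h f
    have h2 : (f a - f b) ^ 2 ≤ 2 / H.c a b * S.energy0 H.c f f := by
      rw [div_mul_eq_mul_div, le_div_iff₀ hc, mul_comm]
      exact H.edge_le_energy0 f ha hb
    nlinarith [sq_nonneg ((f p - f a) - (f a - f b))]
  -- `R` is constant along edges of positive conductance, so its indicator has energy zero and
  -- irreducibility makes it constant on `V0`.
  let u : K → ℝ := fun x => if R x then 1 else 0
  have hu : S.energy0 H.c u u = 0 := by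
    unfold energy0
    rw [Finset.sum_eq_zero, mul_zero]
    intro a ha
    refine Finset.sum_eq_zero fun b hb => ?_
    rcases (H.c_nonneg a ha b hb).eq_or_lt with hc | hc
    · rw [← hc]; ring
    · have hc' : 0 < H.c b a := by rwa [H.c_symm b hb a ha]
      have : R a ↔ R b := ⟨fun h => step a ha b hb h hc, fun h => step b hb a ha h hc'⟩
      simp [u, this]
  have := H.irreducible u hu p hp q hq
  by_contra hq'
  have hq'' : ¬ R q := hq'
  simp [u, hRp, hq''] at this

theorem exists_abs_sub_le_sqrt_energy0 : ∃ C : ℝ, 0 ≤ C ∧ ∀ f : K → ℝ, ∀ p ∈ S.V0, ∀ q ∈ S.V0,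
    |f p - f q| ≤ C * √(S.energy0 H.c f f) := by
  choose! C hC h using fun (p : K) (hp : p ∈ S.V0) (q : K) (hq : q ∈ S.V0) =>
    H.exists_sq_sub_le_energy0_of_mem hp hq
  refine ⟨√(∑ p ∈ S.V0, ∑ q ∈ S.V0, C p q), Real.sqrt_nonneg _, fun f p hp q hq => ?_⟩
  rw [← Real.sqrt_mul (Finset.sum_nonneg fun p hp => Finset.sum_nonneg fun q hq => hC p hp q hq),
    ← Real.sqrt_sq_eq_abs]
  refine Real.sqrt_le_sqrt ((h p hp q hq f).trans ?_)
  refine mul_le_mul_of_nonneg_right ?_ (H.energy0_nonneg f)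
  exact (Finset.single_le_sum (f := C p) (fun q hq => hC p hp q hq) hq).trans
    (Finset.single_le_sum (f := fun p => ∑ q ∈ S.V0, C p q)
      (fun p hp => Finset.sum_nonneg fun q hq => hC p hp q hq) hp)

theorem energy0_le_energy_one (f : K → ℝ) : S.energy0 H.c f f ≤ S.energy H.c H.r 1 f f :=
  (H.restriction f).2 ⟨f, fun _ _ => rfl, rfl⟩

/-- Truncation does not increase energy. -/
theorem energy_clamp_le (a b : ℝ) (m : ℕ) (f : K → ℝ) :
    S.energy H.c H.r m (fun x => max a (min b (f x))) (fun x => max a (min b (f x))) ≤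
      S.energy H.c H.r m f f := by
  unfold energy energy0
  refine Finset.sum_le_sum fun w _ => ?_
  refine mul_le_mul_of_nonneg_left ?_ (inv_nonneg.2 (wordProd_pos H.r_pos w).le)
  refine mul_le_mul_of_nonneg_left ?_ (by norm_num)
  refine Finset.sum_le_sum fun p hp => ?_
  refine Finset.sum_le_sum fun q hq => ?_
  rw [mul_assoc, mul_assoc]
  refine mul_le_mul_of_nonneg_left ?_ (H.c_nonneg p hp q hq)
  rw [← sq, ← sq, sq_le_sq]
  simp only [Function.comp_apply]
  generalize f (S.cellMap w p) = s, f (S.cellMap w q) = t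
  have h1 := abs_max_sub_max_le_max a (min b s) a (min b t)
  have h2 := abs_min_sub_min_le_max b s b t
  simp only [sub_self, abs_zero, abs_nonneg, max_eq_right] at h1 h2
  exact h1.trans h2

/-- `u` is energy minimizing on the vertices of level one for its boundary values, in variational
form. -/
def IsExtremal (u : K → ℝ) : Prop :=
  ∀ v, S.energy H.c H.r 1 u v = S.energy0 H.c u v

variable {H} in
-- The quadratic form of level one minus level zero is nonnegative and vanishes at `u`, so `u` lies
-- in the kernel of its polarization.
theorem IsExtremal.of_energy_eq {u : K → ℝ}
    (hu : S.energy H.c H.r 1 u u = S.energy0 H.c u u) : H.IsExtremal u := by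
  intro v
  set d := S.energy H.c H.r 1 u v - S.energy0 H.c u v with hd
  set e := S.energy H.c H.r 1 v v - S.energy0 H.c v v with he
  have key : ∀ s : ℝ, 0 ≤ 2 * s * d + s * s * e := by
    intro s
    have h := H.energy0_le_energy_one (u + s • v)
    have e := S.energy_zero H.c H.r (u + s • v) (u + s • v)
    rw [energy_add_smul_self] at e h
    simp only [energy_zero] at e
    rw [hd, he]
    nlinarith
  by_contra hne
  have hd0 : d ≠ 0 := fun h => hne (sub_eq_zero.1 h)
  -- For this `s` the linear term of `key` outweighs the quadratic one; adding 1 covers `e = 0`.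
  have h1 := key (-d / (|e| + 1))
  have hpos : 0 < |e| + 1 := by positivity
  have h2 : 2 * (-d / (|e| + 1)) * d + (-d / (|e| + 1)) * (-d / (|e| + 1)) * e
      = d ^ 2 / (|e| + 1) ^ 2 * (e - 2 * (|e| + 1)) := by
    field_simp
    ring
  rw [h2] at h1
  have h3 : 0 < d ^ 2 / (|e| + 1) ^ 2 := by positivity
  nlinarith [le_abs_self e, abs_nonneg e]

variable {H} in
theorem IsExtremal.add {u v : K → ℝ} (hu : H.IsExtremal u) (hv : H.IsExtremal v) :
    H.IsExtremal (u + v) := fun g => by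
  rw [energy_add_left, energy0_add_left, hu, hv]

variable {H} in
theorem IsExtremal.smul {u : K → ℝ} (hu : H.IsExtremal u) (s : ℝ) : H.IsExtremal (s • u) :=
  fun g => by rw [energy_smul_left, energy0_smul_left, hu]

/-- Every boundary function has an extremal extension, whose values at the vertices of level one
respect all bounds of the boundary values. -/
theorem exists_isExtremal (u : K → ℝ) : ∃ f : K → ℝ, (∀ p ∈ S.V0, f p = u p) ∧ H.IsExtremal f ∧
    ∀ a b : ℝ, (∀ p ∈ S.V0, a ≤ u p ∧ u p ≤ b) → ∀ x ∈ S.V 1, a ≤ f x ∧ f x ≤ b := by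
  obtain ⟨f, hfu, hf⟩ := (H.restriction u).1
  have hext : ∀ f : K → ℝ, (∀ p ∈ S.V0, f p = u p) →
      S.energy H.c H.r 1 f f ≤ S.energy0 H.c u u → H.IsExtremal f := fun f hfu hf => by
    refine IsExtremal.of_energy_eq (le_antisymm ?_ (H.energy0_le_energy_one f))
    rwa [S.energy0_congr H.c hfu hfu]
  rcases S.V0.eq_empty_or_nonempty with h0 | h0
  · refine ⟨f, hfu, hext f hfu hf.ge, fun a b _ x hx => ?_⟩
    obtain ⟨w, p, hp, -⟩ := Set.mem_iUnion.1 hx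
    simp [h0] at hp
  obtain ⟨p₀, hp₀, hmin⟩ := S.V0.exists_min_image u h0
  obtain ⟨p₁, hp₁, hmax⟩ := S.V0.exists_max_image u h0
  have hf' : ∀ p ∈ S.V0, max (u p₀) (min (u p₁) (f p)) = u p := fun p hp => by
    rw [hfu p hp, min_eq_right (hmax p hp), max_eq_right (hmin p hp)]
  -- Truncating a minimizer between the extreme boundary values keeps it a minimizer, so the bounds
  -- need no uniqueness.
  refine ⟨fun x => max (u p₀) (min (u p₁) (f x)), hf',
    hext _ hf' ((H.energy_clamp_le _ _ 1 f).trans hf.ge), fun a b hab x _ => ?_⟩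
  exact ⟨(hab p₀ hp₀).1.trans (le_max_left _ _),
    (max_le (hmin p₁ hp₁) (min_le_left _ _)).trans (hab p₁ hp₁).2⟩

end RegularHarmonicStructure

/-! ### Self-similar families of continuous functions -/

/-- Solution of the affine self-similarity equations `Ψ s ∘ F l = Ψ (A l s) + k l s` with boundary
values `b s`, where `B s` are the resulting values at the vertices of level one. -/
theorem exists_selfSimilar_family {K : Type*} [MetricSpace K] [CompactSpace K] {N : ℕ}
    (S : PCFSystem K N) {X : Type*} (A : Fin N → X → X)
    (k : Fin N → X → C(K, ℝ)) (b B : X → K → ℝ)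
    (hB : ∀ s l, ∀ p ∈ S.V0, b (A l s) p + k l s p = B s (S.F l p))
    (hb : ∀ s, ∀ p ∈ S.V0, B s p = b s p)
    (Φ : X → C(K, ℝ)) (hΦ : ∀ s, ∀ p ∈ S.V0, Φ s p = b s p)
    (σ : X → ℝ) (hσ0 : ∀ s, 0 ≤ σ s) (ρ : ℝ) (hρ0 : 0 ≤ ρ) (hρ : ρ < 1)
    (hσ : ∀ l s, σ (A l s) ≤ ρ * σ s)
    (hstart : ∀ s l z, |Φ s (S.F l z) - (Φ (A l s) z + k l s z)| ≤ σ s) :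
    ∃ Ψ : X → C(K, ℝ), (∀ s, ∀ p ∈ S.V0, Ψ s p = b s p) ∧
      ∀ s l z, Ψ s (S.F l z) = Ψ (A l s) z + k l s z := by
  have step : ∀ Φ : {Φ : X → C(K, ℝ) // ∀ s, ∀ p ∈ S.V0, Φ s p = b s p},
      ∃ Φ' : {Φ : X → C(K, ℝ) // ∀ s, ∀ p ∈ S.V0, Φ s p = b s p},
        ∀ s l z, Φ'.1 s (S.F l z) = Φ.1 (A l s) z + k l s z := by
    rintro ⟨Φ, hΦ⟩
    choose Φ' hΦ' using fun s => S.exists_glue (fun l => Φ (A l s) + k l s) (B s)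
      (fun l p hp => by rw [ContinuousMap.add_apply, hΦ _ p hp, hB s l p hp])
    refine ⟨⟨Φ', fun s p hp => ?_⟩, fun s l z => hΦ' s l z⟩
    obtain ⟨l, hl⟩ := S.boundary_fixed p hp
    rw [← hb s p hp, ← hl, hΦ' s l p, ContinuousMap.add_apply, hΦ _ p hp, hB s l p hp]
  choose T hT using step
  -- Picard iteration. Each step glues the right-hand sides of the equations; the prescribed
  -- boundary values are preserved and make the next gluing possible.
  let seq : ℕ → {Φ : X → C(K, ℝ) // ∀ s, ∀ p ∈ S.V0, Φ s p = b s p} := fun n => T^[n] ⟨Φ, hΦ⟩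
  have hseq : ∀ n s l z, (seq (n + 1)).1 s (S.F l z) = (seq n).1 (A l s) z + k l s z := by
    intro n s l z
    simp only [seq, Function.iterate_succ_apply']
    exact hT _ s l z
  -- The error at `s` is bounded by the preceding errors at the parameters `A l s`, where `σ` is
  -- smaller by the factor `ρ`. No bound uniform in `s` is needed.
  have hdist : ∀ n s, dist ((seq n).1 s) ((seq (n + 1)).1 s) ≤ σ s * ρ ^ n := by
    intro n
    induction n with
    | zero =>
      intro s
      rw [ContinuousMap.dist_le (by simpa using hσ0 s)]
      intro x
      obtain ⟨l, z, rfl⟩ := S.exists_F_eq x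
      rw [hseq, Real.dist_eq, pow_zero, mul_one]
      exact hstart s l z
    | succ n ih =>
      intro s
      rw [ContinuousMap.dist_le (mul_nonneg (hσ0 s) (pow_nonneg hρ0 _))]
      intro x
      obtain ⟨l, z, rfl⟩ := S.exists_F_eq x
      rw [hseq, hseq, dist_add_right]
      refine (ContinuousMap.dist_apply_le_dist z).trans ((ih (A l s)).trans ?_)
      rw [pow_succ', ← mul_assoc, mul_comm (σ s)]
      exact mul_le_mul_of_nonneg_right (hσ l s) (pow_nonneg hρ0 n)
  choose Ψ hΨ using fun s =>
    cauchySeq_tendsto_of_complete (cauchySeq_of_le_geometric ρ (σ s) hρ fun n => hdist n s)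
  have hpt : ∀ s x, Tendsto (fun n => (seq n).1 s x) atTop (𝓝 (Ψ s x)) := fun s x =>
    ((continuous_eval_const x).tendsto (Ψ s)).comp (hΨ s)
  refine ⟨Ψ, fun s p hp => ?_, fun s l z => ?_⟩
  · refine tendsto_nhds_unique (hpt s p) ?_
    simp only [(seq _).2 s p hp, tendsto_const_nhds]
  · refine tendsto_nhds_unique ((hpt s (S.F l z)).comp (tendsto_add_atTop_nat 1)) ?_
    simpa only [Function.comp_def, hseq] using (hpt (A l s) z).add_const (k l s z)

/-! ### Harmonic functions: localization, uniqueness, existence -/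

namespace RegularHarmonicStructure

variable {K : Type*} [MetricSpace K] {N : ℕ} {S : PCFSystem K N} (H : S.RegularHarmonicStructure)

/-- Continuous functions that are extremal on every cell. -/
def IsCellExtremal (h : K → ℝ) : Prop :=
  Continuous h ∧ ∀ (m : ℕ) (w : Fin m → Fin N), H.IsExtremal (h ∘ S.cellMap w)

variable {H}

theorem IsExtremal.congr {u v : K → ℝ} (hu : H.IsExtremal u) (h : ∀ x ∈ S.V 1, v x = u x) :
    H.IsExtremal v := fun g => by
  rw [S.energy_congr H.c H.r 1 h (fun _ _ => rfl), hu g,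
    S.energy0_congr H.c (fun p hp => h p (S.boundary_subset_V 1 hp)) (fun _ _ => rfl)]

theorem IsCellExtremal.isExtremal {h : K → ℝ} (hh : H.IsCellExtremal h) : H.IsExtremal h := by
  simpa [cellMap_zero] using hh.2 0 Fin.elim0

theorem IsCellExtremal.comp_F {h : K → ℝ} (hh : H.IsCellExtremal h) (l : Fin N) :
    H.IsCellExtremal (h ∘ S.F l) :=
  ⟨hh.1.comp (S.continuous_F l), fun m w => by
    rw [← comp_cellMap_cons]
    exact hh.2 _ _⟩

theorem IsCellExtremal.add {h h' : K → ℝ} (hh : H.IsCellExtremal h) (hh' : H.IsCellExtremal h') :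
    H.IsCellExtremal (h + h') :=
  ⟨hh.1.add hh'.1, fun m w => (hh.2 m w).add (hh'.2 m w)⟩

theorem IsCellExtremal.smul {h : K → ℝ} (hh : H.IsCellExtremal h) (s : ℝ) :
    H.IsCellExtremal (s • h) :=
  ⟨hh.1.const_smul s, fun m w => (hh.2 m w).smul s⟩

theorem IsCellExtremal.sub {h h' : K → ℝ} (hh : H.IsCellExtremal h) (hh' : H.IsCellExtremal h') :
    H.IsCellExtremal (h - h') := by
  have : h - h' = h + (-1 : ℝ) • h' := by
    ext x
    simp [sub_eq_add_neg]
  rw [this]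
  exact hh.add (hh'.smul _)

/-- Extremality on the cells collapses the levels one after another. For `v` vanishing on `V0` the
energy is therefore zero at every level, which is why harmonic functions have Laplacian 0. -/
theorem IsCellExtremal.energy_eq {h : K → ℝ} (hh : H.IsCellExtremal h) (m : ℕ) (v : K → ℝ) :
    S.energy H.c H.r m h v = S.energy0 H.c h v := by
  induction m generalizing h v with
  | zero => exact S.energy_zero _ _ _ _
  | succ m ih =>
    rw [energy_succ, ← hh.isExtremal v, energy_one]
    exact Finset.sum_congr rfl fun l _ => by rw [ih (hh.comp_F l)]

theorem IsHarmonic.isExtremal {h : K → ℝ} (hh : H.IsHarmonic h) : H.IsExtremal h := by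
  obtain ⟨f, hf, he⟩ := (H.restriction h).1
  refine IsExtremal.of_energy_eq (le_antisymm ?_ (H.energy0_le_energy_one h))
  rw [he]
  exact hh.2 0 f fun x hx => hf x (by rwa [V_zero] at hx)

/-- A competitor for `h ∘ F l` is pasted into the cell of `l` and `h` is kept elsewhere; the
energies of the other cells cancel. -/
theorem IsHarmonic.comp_F {h : K → ℝ} (hh : H.IsHarmonic h) (l : Fin N) :
    H.IsHarmonic (h ∘ S.F l) := by
  classical
  refine ⟨hh.1.comp (S.continuous_F l), fun m f hf => ?_⟩
  -- Competitors need not be continuous. Cells meet only in boundary points, where `f` agrees with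
  -- `h ∘ F l`, so the pasted function agrees with `h` on the other cells.
  let f' : K → ℝ := fun x => if hx : ∃ z, S.F l z = x then f hx.choose else h x
  have hf' : ∀ z, f' (S.F l z) = f z := fun z => by
    have hx : ∃ z', S.F l z' = S.F l z := ⟨z, rfl⟩
    simp only [f', dif_pos hx]
    rw [S.injective l hx.choose_spec]
  have hf'' : ∀ l' ≠ l, ∀ z, f' (S.F l' z) = h (S.F l' z) := fun l' hl' z => by
    by_cases hx : ∃ z', S.F l z' = S.F l' z
    · obtain ⟨z', hz'⟩ := hx
      rw [← hz', hf']
      exact hf z' (S.boundary_subset_V m (S.mem_boundary_of_F_eq hl'.symm hz').1)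
    · simp only [f', dif_neg hx]
  have hV : ∀ x ∈ S.V (m + 1), f' x = h x := fun x hx => by
    obtain ⟨l', z, hz, rfl⟩ := S.mem_V_succ.1 hx
    by_cases hl' : l' = l
    · subst hl'
      rw [hf']
      exact hf z hz
    · exact hf'' l' hl' z
  have key := hh.2 (m + 1) f' hV
  rw [energy_succ, energy_succ S H.c H.r (m + 1) f' f',
    ← Finset.add_sum_erase _ _ (Finset.mem_univ l),
    ← Finset.add_sum_erase (a := l) _ _ (Finset.mem_univ l)] at key
  have e1 : f' ∘ S.F l = f := funext hf'
  have e2 : ∀ l' ∈ Finset.univ.erase l,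
      (H.r l')⁻¹ * S.energy H.c H.r (m + 1) (f' ∘ S.F l') (f' ∘ S.F l') =
        (H.r l')⁻¹ * S.energy H.c H.r (m + 1) (h ∘ S.F l') (h ∘ S.F l') := fun l' hl' => by
    rw [show f' ∘ S.F l' = h ∘ S.F l' from funext (hf'' l' (Finset.ne_of_mem_erase hl'))]
  rw [Finset.sum_congr rfl e2, e1] at key
  exact le_of_mul_le_mul_left (le_of_add_le_add_right key) (inv_pos.2 (H.r_pos l))

/-- Replaces minimality by a condition that is linear in `h` and passes to cells. -/
theorem isHarmonic_iff_isCellExtremal {h : K → ℝ} : H.IsHarmonic h ↔ H.IsCellExtremal h := by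
  constructor
  · intro hh
    refine ⟨hh.1, fun m => ?_⟩
    induction m generalizing h with
    | zero =>
      intro w
      simpa [cellMap_zero] using hh.isExtremal
    | succ m ih =>
      intro w
      rw [cellMap_succ, ← Function.comp_assoc]
      exact ih (hh.comp_F _) _
  · intro hh
    refine ⟨hh.1, fun m => ?_⟩
    induction m generalizing h with
    | zero =>
      intro f hf
      rw [zero_add, hh.isExtremal h]
      rw [V_zero] at hf
      rw [← S.energy0_congr H.c hf hf]
      exact H.energy0_le_energy_one f
    | succ m ih =>
      intro f hf
      rw [energy_succ, energy_succ S H.c H.r (m + 1) f f]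
      refine Finset.sum_le_sum fun l _ => ?_
      exact mul_le_mul_of_nonneg_left
        (ih (hh.comp_F l) _ fun x hx => hf _ (S.F_mem_V_succ hx l)) (inv_pos.2 (H.r_pos l)).le

/-- By connectedness of `K`, the energy of level one is definite on the functions that vanish at
the boundary. -/
theorem eq_zero_of_energy_one_eq_zero [CompactSpace K] [ConnectedSpace K]
    (hne : S.V0.Nonempty) {f : K → ℝ} (h0 : ∀ p ∈ S.V0, f p = 0)
    (hf : S.energy H.c H.r 1 f f = 0) : ∀ x ∈ S.V 1, f x = 0 := by
  rw [energy_one, Finset.sum_eq_zero_iff_of_nonneg fun l _ =>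
    mul_nonneg (inv_pos.2 (H.r_pos l)).le (H.energy0_nonneg _)] at hf
  have hconst : ∀ l, ∀ p ∈ S.V0, ∀ q ∈ S.V0, f (S.F l p) = f (S.F l q) := fun l => by
    refine H.irreducible (f ∘ S.F l) ?_
    have := hf l (Finset.mem_univ l)
    exact (mul_eq_zero.1 this).resolve_left (inv_pos.2 (H.r_pos l)).ne'
  obtain ⟨p₀, hp₀⟩ := hne
  have hclosed : ∀ s : Set (Fin N), IsClosed (⋃ l ∈ s, Set.range (S.F l)) := fun s =>
    s.toFinite.isClosed_biUnion fun l _ => (isCompact_range (S.continuous_F l)).isClosed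
  -- `f` is constant on the vertices of each cell. If some constants were nonzero, the cells with
  -- and without constant 0 would form two nonempty closed sets covering `K`; by connectedness they
  -- meet, at a vertex common to two cells, where the constants agree.
  let P : Set (Fin N) := {l | f (S.F l p₀) = 0}
  have hall : ∀ l, l ∈ P := by
    by_contra hcon
    push Not at hcon
    obtain ⟨l₁, hl₁⟩ := hcon
    obtain ⟨l₀, hl₀⟩ := S.boundary_fixed p₀ hp₀
    have hcov : (Set.univ : Set K) ⊆ (⋃ l ∈ P, Set.range (S.F l)) ∪ ⋃ l ∈ Pᶜ, Set.range (S.F l) := by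
      intro x _
      obtain ⟨l, z, rfl⟩ := S.exists_F_eq x
      by_cases hl : l ∈ P
      · exact Or.inl (Set.mem_biUnion hl ⟨z, rfl⟩)
      · exact Or.inr (Set.mem_biUnion hl ⟨z, rfl⟩)
    obtain ⟨x, -, hx1, hx2⟩ := isPreconnected_closed_iff.1 isPreconnected_univ _ _ (hclosed P)
      (hclosed Pᶜ) hcov
      ⟨S.F l₀ p₀, trivial, Set.mem_biUnion (show l₀ ∈ P by simp [P, hl₀, h0 p₀ hp₀]) ⟨p₀, rfl⟩⟩
      ⟨S.F l₁ p₀, trivial, Set.mem_biUnion (show l₁ ∈ Pᶜ from hl₁) ⟨p₀, rfl⟩⟩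
    simp only [Set.mem_iUnion, Set.mem_range] at hx1 hx2
    obtain ⟨l, hl, z, rfl⟩ := hx1
    obtain ⟨l', hl', z', hz'⟩ := hx2
    have hne : l' ≠ l := fun e => hl' (e ▸ hl)
    obtain ⟨hz1, hz2⟩ := S.mem_boundary_of_F_eq hne hz'
    apply hl'
    change f (S.F l' p₀) = 0
    rw [hconst l' p₀ hp₀ z' hz1, hz', hconst l z hz2 p₀ hp₀]
    exact hl
  intro x hx
  obtain ⟨l, z, hz, rfl⟩ := S.mem_V_succ.1 hx
  rw [V_zero] at hz
  rw [hconst l z hz p₀ hp₀]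
  exact hall l

section Principle

variable [CompactSpace K] [ConnectedSpace K]

/-- Definiteness makes the extremal extension unique on `V 1`, so `h` inherits the bounds of the one
from `exists_isExtremal`. -/
theorem IsExtremal.nonneg (hne : S.V0.Nonempty) {h : K → ℝ} (hh : H.IsExtremal h)
    (h0 : ∀ p ∈ S.V0, 0 ≤ h p) : ∀ x ∈ S.V 1, 0 ≤ h x := by
  obtain ⟨f, hf, hfe, hfb⟩ := H.exists_isExtremal h
  obtain ⟨p₁, hp₁, hmax⟩ := S.V0.exists_max_image h hne
  intro x hx
  have hd : ∀ p ∈ S.V0, (h + (-1 : ℝ) • f) p = 0 := fun p hp => by simp [hf p hp]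
  have hz := eq_zero_of_energy_one_eq_zero hne (H := H) hd (by
    rw [hh.add (hfe.smul _)]
    rw [S.energy0_congr H.c (f' := 0) (g' := 0) hd hd]
    simp [energy0]) x hx
  have : h x = f x := by
    simp only [Pi.add_apply, Pi.smul_apply, smul_eq_mul] at hz
    linarith
  rw [this]
  exact (hfb 0 (h p₁) (fun p hp => ⟨h0 p hp, hmax p hp⟩) x hx).1

theorem IsCellExtremal.nonneg (hne : S.V0.Nonempty) {h : K → ℝ} (hh : H.IsCellExtremal h)
    (h0 : ∀ p ∈ S.V0, 0 ≤ h p) (x : K) : 0 ≤ h x := by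
  refine S.le_of_le_on_V hne continuous_const hh.1 (fun m => ?_) x
  induction m generalizing h with
  | zero =>
    intro x hx
    rw [V_zero] at hx
    exact h0 x hx
  | succ m ih =>
    intro x hx
    obtain ⟨l, z, hz, rfl⟩ := S.mem_V_succ.1 hx
    refine ih (hh.comp_F l) (fun p hp => ?_) z hz
    exact hh.isExtremal.nonneg hne h0 _ (S.F_mem_V_succ (S.boundary_subset_V 0 hp) l)

theorem IsCellExtremal.eq_of_eq (hne : S.V0.Nonempty) {h h' : K → ℝ} (hh : H.IsCellExtremal h)
    (hh' : H.IsCellExtremal h') (h0 : ∀ p ∈ S.V0, h p = h' p) : h = h' := by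
  funext x
  have h1 := (hh.sub hh').nonneg hne (fun p hp => by simp [h0 p hp]) x
  have h2 := (hh'.sub hh).nonneg hne (fun p hp => by simp [h0 p hp]) x
  simp only [Pi.sub_apply] at h1 h2
  linarith

end Principle

/-- Tietze extension from the finite set `V0`; it starts the iteration, and its range bounds the
first error by the oscillation of `u`. -/
theorem exists_continuousMap_boundary [CompactSpace K] (hne : S.V0.Nonempty) (u : K → ℝ) :
    ∃ φ : C(K, ℝ), (∀ p ∈ S.V0, φ p = u p) ∧
      ∀ x, ∃ p ∈ S.V0, ∃ q ∈ S.V0, u p ≤ φ x ∧ φ x ≤ u q := by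
  obtain ⟨p₀, hp₀, hmin⟩ := S.V0.exists_min_image u hne
  obtain ⟨p₁, hp₁, hmax⟩ := S.V0.exists_max_image u hne
  have hfin : Finite (S.V0 : Set K) := S.V0.finite_toSet
  let f : C((S.V0 : Set K), ℝ) := ⟨fun x => u x, continuous_of_discreteTopology⟩
  obtain ⟨g, hg, hgf⟩ := f.exists_restrict_eq_forall_mem_of_closed (t := Set.Icc (u p₀) (u p₁))
    (fun x => ⟨hmin x x.2, hmax x x.2⟩) ⟨u p₀, le_rfl, hmin p₁ hp₁⟩ S.V0.finite_toSet.isClosed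
  refine ⟨g, fun p hp => ?_, fun x => ⟨p₀, hp₀, p₁, hp₁, hg x⟩⟩
  exact congrArg (fun F => F (⟨p, hp⟩ : (S.V0 : Set K))) hgf

/-- A single cell carries at most the whole energy of level one. This is the source of the
convergence rate `√(r l)`. -/
theorem IsExtremal.energy0_comp_F_le {u : K → ℝ} (hu : H.IsExtremal u) (l : Fin N) :
    S.energy0 H.c (u ∘ S.F l) (u ∘ S.F l) ≤ H.r l * S.energy0 H.c u u := by
  rw [← hu u, energy_one, ← inv_mul_le_iff₀ (H.r_pos l)]
  exact Finset.single_le_sum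
    (f := fun l => (H.r l)⁻¹ * S.energy0 H.c (u ∘ S.F l) (u ∘ S.F l))
    (fun l _ => mul_nonneg (inv_pos.2 (H.r_pos l)).le (H.energy0_nonneg _)) (Finset.mem_univ l)

variable (H) in
/-- The harmonic function with given boundary values. -/
theorem exists_isCellExtremal [CompactSpace K] (hne : S.V0.Nonempty) (u : K → ℝ) :
    ∃ h : K → ℝ, H.IsCellExtremal h ∧ ∀ p ∈ S.V0, h p = u p := by
  choose E hE hEe hEb using H.exists_isExtremal
  choose Φ hΦ hΦb using exists_continuousMap_boundary (S := S) hne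
  obtain ⟨C, hC, hosc⟩ := H.exists_abs_sub_le_sqrt_energy0
  obtain ⟨ρ, hρ0, hρ1, hρ⟩ := exists_uniform_bound_lt_one (fun l => √(H.r l)) fun l => by
    rw [← Real.sqrt_one]
    exact Real.sqrt_lt_sqrt (H.r_pos l).le (H.r_lt_one l)
  -- The parameter is the boundary function, and the equations are `Ψ u ∘ F l = Ψ (E u ∘ F l)`. The
  -- size `σ` is the bound of the oscillation by the root of the energy.
  obtain ⟨Ψ, hΨb, hΨ⟩ := S.exists_selfSimilar_family (fun l (u : K → ℝ) => E u ∘ S.F l)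
    (fun _ _ => 0) (fun u => u) E (fun u l p hp => by simp) hE Φ hΦ
    (fun u => C * √(S.energy0 H.c u u)) (fun u => mul_nonneg hC (Real.sqrt_nonneg _)) ρ hρ0 hρ1
    (fun l u => by
      rw [mul_left_comm]
      refine mul_le_mul_of_nonneg_left ?_ hC
      refine (Real.sqrt_le_sqrt ((hEe u).energy0_comp_F_le l)).trans ?_
      rw [Real.sqrt_mul (H.r_pos l).le, S.energy0_congr H.c (hE u) (hE u)]
      exact mul_le_mul_of_nonneg_right (hρ l) (Real.sqrt_nonneg _))
    (fun u l z => by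
      obtain ⟨p₀, hp₀, hmin⟩ := S.V0.exists_min_image u hne
      obtain ⟨p₁, hp₁, hmax⟩ := S.V0.exists_max_image u hne
      obtain ⟨p, hp, q, hq, h1, h2⟩ := hΦb u (S.F l z)
      obtain ⟨p', hp', q', hq', h3, h4⟩ := hΦb (E u ∘ S.F l) z
      have hb := fun x hx => hEb u (u p₀) (u p₁) (fun p hp => ⟨hmin p hp, hmax p hp⟩) x hx
      have h5 := (hb _ (S.F_mem_V_succ (S.boundary_subset_V 0 hp') l)).1
      have h6 := (hb _ (S.F_mem_V_succ (S.boundary_subset_V 0 hq') l)).2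
      have h7 := (abs_le.1 (hosc u p₁ hp₁ p₀ hp₀)).2
      have h8 := hmin p hp
      have h9 := hmax q hq
      simp only [Function.comp_apply] at h3 h4
      simp only [ContinuousMap.zero_apply, add_zero]
      rw [abs_le]
      constructor <;> linarith)
  have hV1 : ∀ u, ∀ x ∈ S.V 1, Ψ u x = E u x := fun u x hx => by
    obtain ⟨l, z, hz, rfl⟩ := S.mem_V_succ.1 hx
    rw [V_zero] at hz
    rw [hΨ, hΨb _ z hz]
    simp
  have hcell : ∀ (m : ℕ) (w : Fin m → Fin N) (u : K → ℝ), H.IsExtremal (Ψ u ∘ S.cellMap w) := by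
    intro m
    induction m with
    | zero =>
      intro w u
      rw [cellMap_zero]
      exact (hEe u).congr (hV1 u)
    | succ m ih =>
      intro w u
      rw [cellMap_succ, ← Function.comp_assoc]
      have : Ψ u ∘ S.F (w 0) = Ψ (E u ∘ S.F (w 0)) := by
        funext z
        simp [hΨ]
      rw [this]
      exact ih _ _
  exact ⟨Ψ u, ⟨(Ψ u).continuous, fun m w => hcell m w u⟩, hΨb u⟩

end RegularHarmonicStructure

/-! ### Splines, tent functions and the discrete Poisson equation -/

namespace RegularHarmonicStructure

variable {K : Type*} [MetricSpace K] {N : ℕ} {S : PCFSystem K N} (H : S.RegularHarmonicStructure)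

/-- Continuous functions that are harmonic on every cell of level `m`. -/
def IsSpline (m : ℕ) (u : K → ℝ) : Prop :=
  Continuous u ∧ ∀ w : Fin m → Fin N, H.IsCellExtremal (u ∘ S.cellMap w)

variable {H}

theorem isSpline_zero {u : K → ℝ} : H.IsSpline 0 u ↔ H.IsCellExtremal u :=
  ⟨fun h => by simpa [cellMap_zero] using h.2 Fin.elim0,
    fun h => ⟨h.1, fun w => by simpa [cellMap_zero] using h⟩⟩

theorem isSpline_succ {m : ℕ} {u : K → ℝ} :
    H.IsSpline (m + 1) u ↔ Continuous u ∧ ∀ l, H.IsSpline m (u ∘ S.F l) := by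
  constructor
  · refine fun h => ⟨h.1, fun l => ⟨h.1.comp (S.continuous_F l), fun w => ?_⟩⟩
    rw [← comp_cellMap_cons]
    exact h.2 _
  · refine fun h => ⟨h.1, fun w => ?_⟩
    rw [cellMap_succ, ← Function.comp_assoc]
    exact (h.2 _).2 _

theorem IsCellExtremal.isSpline {u : K → ℝ} (hu : H.IsCellExtremal u) (m : ℕ) :
    H.IsSpline m u := by
  induction m generalizing u with
  | zero => exact isSpline_zero.2 hu
  | succ m ih => exact isSpline_succ.2 ⟨hu.1, fun l => ih (hu.comp_F l)⟩

theorem IsSpline.sub {m : ℕ} {u v : K → ℝ} (hu : H.IsSpline m u) (hv : H.IsSpline m v) :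
    H.IsSpline m (u - v) :=
  ⟨hu.1.sub hv.1, fun w => (hu.2 w).sub (hv.2 w)⟩

theorem isTent_iff {m : ℕ} {x : K} {ψ : K → ℝ} :
    H.IsTent m x ψ ↔ H.IsSpline m ψ ∧ ψ x = 1 ∧ ∀ y ∈ S.V m, y ≠ x → ψ y = 0 := by
  simp only [IsTent, IsSpline, isHarmonic_iff_isCellExtremal, and_assoc]

theorem exists_isSpline [CompactSpace K] (hne : S.V0.Nonempty) (m : ℕ) (b : K → ℝ) :
    ∃ u : K → ℝ, H.IsSpline m u ∧ ∀ x ∈ S.V m, u x = b x := by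
  induction m generalizing b with
  | zero =>
    obtain ⟨h, hh, hb⟩ := H.exists_isCellExtremal hne b
    exact ⟨h, isSpline_zero.2 hh, fun x hx => hb x (by rwa [V_zero] at hx)⟩
  | succ m ih =>
    choose u hu hub using fun l => ih (b ∘ S.F l)
    obtain ⟨G, hG⟩ := S.exists_glue (fun l => ⟨u l, (hu l).1⟩) b
      (fun l p hp => hub l p (S.boundary_subset_V m hp))
    refine ⟨G, isSpline_succ.2 ⟨G.continuous, fun l => ?_⟩, fun x hx => ?_⟩
    · rw [show G ∘ S.F l = u l from funext (hG l)]
      exact hu l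
    · obtain ⟨l, z, hz, rfl⟩ := S.mem_V_succ.1 hx
      rw [hG]
      exact hub l z hz

theorem exists_isTent [CompactSpace K] (hne : S.V0.Nonempty) {m : ℕ} {x : K} (hx : x ∈ S.V m) :
    ∃ ψ, H.IsTent m x ψ := by
  classical
  obtain ⟨u, hu, hub⟩ := exists_isSpline (H := H) hne m (fun y => if y = x then 1 else 0)
  refine ⟨u, isTent_iff.2 ⟨hu, by simp [hub x hx], fun y hy hyx => by simp [hub y hy, hyx]⟩⟩

theorem IsTent.comp_F {m : ℕ} {x : K} {ψ : K → ℝ} {l : Fin N}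
    (h : H.IsTent (m + 1) (S.F l x) ψ) : H.IsTent m x (ψ ∘ S.F l) := by
  rw [isTent_iff] at h ⊢
  exact ⟨(isSpline_succ.1 h.1).2 l, h.2.1, fun y hy hyx =>
    h.2.2 _ (S.F_mem_V_succ hy l) fun e => hyx (S.injective l e)⟩

section Principle

variable [CompactSpace K] [ConnectedSpace K]

theorem IsSpline.nonneg (hne : S.V0.Nonempty) {m : ℕ} {u : K → ℝ} (hu : H.IsSpline m u)
    (h0 : ∀ x ∈ S.V m, 0 ≤ u x) (x : K) : 0 ≤ u x := by
  obtain ⟨w, z, rfl⟩ := S.exists_cellMap_eq m x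
  exact (hu.2 w).nonneg hne (fun p hp => h0 _ (S.cellMap_mem_V w hp)) z

theorem IsSpline.eq_of_eq (hne : S.V0.Nonempty) {m : ℕ} {u v : K → ℝ} (hu : H.IsSpline m u)
    (hv : H.IsSpline m v) (h : ∀ x ∈ S.V m, u x = v x) : u = v := by
  funext x
  have h1 := (hu.sub hv).nonneg hne (fun p hp => by simp [h p hp]) x
  have h2 := (hv.sub hu).nonneg hne (fun p hp => by simp [h p hp]) x
  simp only [Pi.sub_apply] at h1 h2
  linarith

theorem IsTent.unique (hne : S.V0.Nonempty) {m : ℕ} {x : K} {ψ ψ' : K → ℝ}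
    (h : H.IsTent m x ψ) (h' : H.IsTent m x ψ') : ψ = ψ' := by
  rw [isTent_iff] at h h'
  refine h.1.eq_of_eq hne h'.1 fun y hy => ?_
  by_cases hyx : y = x
  · rw [hyx, h.2.1, h'.2.1]
  · rw [h.2.2 y hy hyx, h'.2.2 y hy hyx]

theorem IsTent.nonneg (hne : S.V0.Nonempty) {m : ℕ} {x : K} {ψ : K → ℝ}
    (h : H.IsTent m x ψ) (z : K) : 0 ≤ ψ z := by
  rw [isTent_iff] at h
  refine h.1.nonneg hne (fun y hy => ?_) z
  by_cases hyx : y = x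
  · rw [hyx, h.2.1]; exact zero_le_one
  · rw [h.2.2 y hy hyx]

/-- Since `x` is not a boundary point, `F l x` lies in no other cell. On such a cell the tent is a
spline with zero vertex values. -/
theorem IsTent.comp_F_eq_zero (hne : S.V0.Nonempty) {m : ℕ} {x : K} (hx : x ∉ S.V0) {ψ : K → ℝ}
    {l l' : Fin N} (hl : l' ≠ l) (h : H.IsTent (m + 1) (S.F l x) ψ) (z : K) :
    ψ (S.F l' z) = 0 := by
  rw [isTent_iff] at h
  have hs := (isSpline_succ.1 h.1).2 l'
  have h0 : ∀ y ∈ S.V m, ψ (S.F l' y) = 0 := fun y hy =>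
    h.2.2 _ (S.F_mem_V_succ hy l') fun e => hx (S.mem_boundary_of_F_eq hl e).2
  have := congrFun (hs.eq_of_eq hne (hs.sub hs) fun y hy => by simp [h0 y hy]) z
  simpa using this

end Principle

/-- Summation by parts, using the symmetry of the conductances. -/
theorem energy0_eq_sum (f v : K → ℝ) :
    S.energy0 H.c f v = ∑ p ∈ S.V0, ∑ q ∈ S.V0, H.c p q * (f p - f q) * v p := by
  have h : ∑ p ∈ S.V0, ∑ q ∈ S.V0, H.c p q * (f p - f q) * v q =
      -∑ p ∈ S.V0, ∑ q ∈ S.V0, H.c p q * (f p - f q) * v p := by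
    rw [Finset.sum_comm, ← Finset.sum_neg_distrib]
    refine Finset.sum_congr rfl fun p hp => ?_
    rw [← Finset.sum_neg_distrib]
    refine Finset.sum_congr rfl fun q hq => ?_
    rw [H.c_symm q hq p hp]
    ring
  unfold energy0
  simp only [mul_sub _ (v _), Finset.sum_sub_distrib, h]
  ring

/-- The graph Laplacian is the energy against the discrete point mass. -/
theorem graphLaplacian_eq_neg_energy (m : ℕ) (f : K → ℝ) {x : K} {v : K → ℝ} (hx : v x = 1)
    (hv : ∀ y ∈ S.V m, y ≠ x → v y = 0) :
    H.graphLaplacian m f x = -S.energy H.c H.r m f v := by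
  unfold graphLaplacian energy
  rw [← Finset.sum_neg_distrib]
  refine Finset.sum_congr rfl fun w _ => ?_
  rw [energy0_eq_sum, Finset.mul_sum, ← Finset.sum_neg_distrib]
  refine Finset.sum_congr rfl fun p hp => ?_
  rw [Finset.mul_sum, ← Finset.sum_neg_distrib]
  refine Finset.sum_congr rfl fun q hq => ?_
  simp only [Function.comp_apply]
  split_ifs with h
  · rw [h, hx]
    ring
  · rw [hv _ (S.cellMap_mem_V w hp) h]
    ring

theorem IsTent.graphLaplacian_eq {m : ℕ} {x : K} {ψ : K → ℝ} (h : H.IsTent m x ψ) (f : K → ℝ) :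
    H.graphLaplacian m f x = -S.energy H.c H.r m f ψ :=
  graphLaplacian_eq_neg_energy m f h.2.2.1 h.2.2.2

theorem IsTent.eq_zero_of_mem_boundary {m : ℕ} {x : K} {ψ : K → ℝ} (h : H.IsTent m x ψ)
    (hx : x ∉ S.V0) : ∀ p ∈ S.V0, ψ p = 0 := fun p hp =>
  h.2.2.2 p (S.boundary_subset_V m hp) fun e => hx (e ▸ hp)

/-- The Poisson equation on the vertices of level one. -/
theorem exists_energy_one_eq [CompactSpace K] [ConnectedSpace K] (hne : S.V0.Nonempty) (Λ : (K → ℝ) →ₗ[ℝ] ℝ)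
    (hΛ : ∀ v, (∀ x ∈ S.V 1, v x = 0) → Λ v = 0) :
    ∃ η : K → ℝ, (∀ p ∈ S.V0, η p = 0) ∧
      ∀ v, (∀ p ∈ S.V0, v p = 0) → S.energy H.c H.r 1 η v = Λ v := by
  classical
  let T := {x : K // x ∈ S.V 1 ∧ x ∉ S.V0}
  have : Finite T := ((S.finite_V 1).subset fun x hx => hx.1 : {x | x ∈ S.V 1 ∧ x ∉ S.V0}.Finite)
  have := Fintype.ofFinite T
  let ext : (T → ℝ) →ₗ[ℝ] (K → ℝ) := Function.ExtendByZero.linearMap ℝ Subtype.val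
  have hextT : ∀ v (x : T), ext v x = v x := fun v x =>
    Subtype.val_injective.extend_apply v (0 : K → ℝ) x
  have hextB : ∀ v, ∀ p ∈ S.V0, ext v p = 0 := fun v p hp => by
    refine (Function.extend_apply' v (0 : K → ℝ) p ?_).trans rfl
    rintro ⟨x, rfl⟩
    exact x.2.2 hp
  -- The energy on interior vertices of level one, extended by zero. It is definite, so `B` is
  -- injective and, by equality of dimensions, surjective.
  let B : (T → ℝ) →ₗ[ℝ] Module.Dual ℝ (T → ℝ) :=
    LinearMap.mk₂ ℝ (fun v v' => S.energy H.c H.r 1 (ext v) (ext v'))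
      (fun a b c => by rw [map_add, energy_add_left])
      (fun s a b => by rw [map_smul, energy_smul_left, smul_eq_mul])
      (fun a b c => by rw [map_add, energy_add_right])
      (fun s a b => by rw [map_smul, energy_smul_right, smul_eq_mul])
  have hinj : Function.Injective B := by
    rw [← LinearMap.ker_eq_bot, LinearMap.ker_eq_bot']
    intro v hv
    have hE : S.energy H.c H.r 1 (ext v) (ext v) = 0 := congrArg (fun φ => φ v) hv
    funext x
    exact (hextT v x).symm.trans (eq_zero_of_energy_one_eq_zero hne (hextB v) hE x x.2.1)
  obtain ⟨v₀, hv₀⟩ := (LinearMap.injective_iff_surjective_of_finrank_eq_finrank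
    Subspace.dual_finrank_eq.symm).1 hinj (Λ ∘ₗ ext)
  refine ⟨ext v₀, hextB v₀, fun v hv => ?_⟩
  have hvV : ∀ x ∈ S.V 1, v x = ext (fun y : T => v y) x := fun x hx => by
    by_cases hxB : x ∈ S.V0
    · rw [hv x hxB, hextB _ x hxB]
    · exact (hextT (fun y : T => v y) ⟨x, hx, hxB⟩).symm
  rw [S.energy_congr H.c H.r 1 (f' := ext v₀) (fun _ _ => rfl) hvV]
  have h1 : S.energy H.c H.r 1 (ext v₀) (ext fun y : T => v y) = Λ (ext fun y : T => v y) :=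
    congrArg (fun φ => φ (fun y : T => v y)) hv₀
  rw [h1, ← sub_eq_zero, ← map_sub]
  exact hΛ _ fun x hx => by simp [hvV x hx]

end RegularHarmonicStructure

/-! ### Positivity of the measure and the Green potential -/

section Integral

variable {K : Type*} [MetricSpace K] [CompactSpace K] [MeasurableSpace K] [BorelSpace K] {N : ℕ} {S : PCFSystem K N} {t : Fin N → ℝ} {μ : Measure K}

theorem IsSelfSimilarMeasure.measure_cell_pos (hμ : S.IsSelfSimilarMeasure t μ) {m : ℕ}
    (w : Fin m → Fin N) : 0 < μ (Set.range (S.cellMap w)) := by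
  have := hμ.prob
  induction m with
  | zero => simp [cellMap_zero]
  | succ m ih =>
    rw [hμ.self_similar _ (isCompact_range (S.continuous_cellMap w)).isClosed.measurableSet]
    refine lt_of_lt_of_le ?_ (Finset.single_le_sum (fun _ _ => zero_le) (Finset.mem_univ (w 0)))
    refine ENNReal.mul_pos (by simpa using hμ.weight_pos (w 0)) ?_
    rw [cellMap_succ, Set.range_comp, Set.preimage_image_eq _ (S.injective _)]
    exact (ih _).ne'

theorem IsSelfSimilarMeasure.isOpenPosMeasure (hμ : S.IsSelfSimilarMeasure t μ) :
    μ.IsOpenPosMeasure := by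
  refine ⟨fun U hU ⟨x, hx⟩ => ?_⟩
  obtain ⟨ε, hε, hball⟩ := Metric.isOpen_iff.1 hU x hx
  obtain ⟨M, hM⟩ := S.exists_level_dist_lt hε
  obtain ⟨w, z, rfl⟩ := S.exists_cellMap_eq M x
  refine ((hμ.measure_cell_pos w).trans_le (measure_mono ?_)).ne'
  rintro _ ⟨y, rfl⟩
  exact hball (hM M le_rfl w y z)

namespace RegularHarmonicStructure

variable [ConnectedSpace K] {H : S.RegularHarmonicStructure}

theorem IsTent.integral_pos (hμ : S.IsSelfSimilarMeasure t μ) (hne : S.V0.Nonempty) {m : ℕ}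
    {x : K} {ψ : K → ℝ} (h : H.IsTent m x ψ) : 0 < ∫ z, ψ z ∂μ := by
  have := hμ.prob
  have := hμ.isOpenPosMeasure
  refine h.1.integral_pos_of_hasCompactSupport_nonneg_nonzero
    (HasCompactSupport.of_compactSpace ψ) (h.nonneg hne) (x := x) ?_
  rw [h.2.2.1]
  exact one_ne_zero

theorem IsTent.integral_eq (hμ : S.IsSelfSimilarMeasure t μ) (hne : S.V0.Nonempty) {m : ℕ}
    {x : K} (hx : x ∉ S.V0) {ψ : K → ℝ} {l : Fin N} (h : H.IsTent (m + 1) (S.F l x) ψ) :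
    ∫ z, ψ z ∂μ = t l * ∫ z, ψ (S.F l z) ∂μ := by
  rw [hμ.integral_eq_sum h.1]
  refine Finset.sum_eq_single l (fun l' _ hl' => ?_) (fun h => absurd (Finset.mem_univ l) h)
  simp [h.comp_F_eq_zero hne hx hl']

/-- The Green potential `-η` of the measure: `η` vanishes at the boundary and solves `Δ η = 1` in
the weak sense. -/
theorem exists_weak_potential (hμ : S.IsSelfSimilarMeasure t μ) (hne : S.V0.Nonempty) :
    ∃ η : K → ℝ, Continuous η ∧ (∀ p ∈ S.V0, η p = 0) ∧
      ∀ m u, H.IsSpline m u → (∀ p ∈ S.V0, u p = 0) →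
        S.energy H.c H.r m η u = -∫ z, u z ∂μ := by
  choose E hE hEb using H.exists_isCellExtremal hne
  have hEadd : ∀ u v, E (u + v) = E u + E v := fun u v =>
    (hE _).eq_of_eq hne ((hE u).add (hE v)) fun p hp => by simp [hEb _ p hp]
  have hEsmul : ∀ (s : ℝ) u, E (s • u) = s • E u := fun s u =>
    (hE _).eq_of_eq hne ((hE u).smul s) fun p hp => by simp [hEb _ p hp]
  -- Minus the integral of the level-one spline with the vertex values of `v`.
  let Λ : (K → ℝ) →ₗ[ℝ] ℝ :=
    { toFun := fun v => -∑ l, t l * ∫ z, E (v ∘ S.F l) z ∂μ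
      map_add' := fun u v => by
        rw [← neg_add, ← Finset.sum_add_distrib]
        congr 1
        refine Finset.sum_congr rfl fun l _ => ?_
        rw [show (u + v) ∘ S.F l = u ∘ S.F l + v ∘ S.F l from rfl, hEadd, ← mul_add,
          ← integral_add (hμ.integrable (hE _).1) (hμ.integrable (hE _).1)]
        rfl
      map_smul' := fun s u => by
        simp only [RingHom.id_apply, smul_eq_mul]
        rw [mul_neg, Finset.mul_sum]
        congr 1
        refine Finset.sum_congr rfl fun l _ => ?_
        rw [show (s • u) ∘ S.F l = s • (u ∘ S.F l) from rfl, hEsmul, mul_left_comm s,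
          ← integral_const_mul s]
        rfl }
  obtain ⟨η₁, hη₁b, hη₁⟩ := exists_energy_one_eq (H := H) hne Λ fun v hv => by
    change -∑ l, t l * ∫ z, E (v ∘ S.F l) z ∂μ = 0
    rw [Finset.sum_eq_zero, neg_zero]
    intro l _
    have : E (v ∘ S.F l) = (0 : ℝ) • E 0 := (hE _).eq_of_eq hne ((hE 0).smul 0) fun p hp => by
      rw [hEb _ p hp, Function.comp_apply, hv _ (S.F_mem_V_succ (S.boundary_subset_V 0 hp) l)]
      simp
    simp [this]
  have ht1 : ∀ l, t l ≤ 1 := fun l => by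
    rw [← hμ.weight_sum]
    exact Finset.single_le_sum (fun l _ => (hμ.weight_pos l).le) (Finset.mem_univ l)
  obtain ⟨ρ, hρ0, hρ1, hρ⟩ := exists_uniform_bound_lt_one (fun l => H.r l * t l) fun l =>
    (mul_le_of_le_one_right (H.r_pos l).le (ht1 l)).trans_lt (H.r_lt_one l)
  let h : Fin N → C(K, ℝ) := fun l => ⟨E (η₁ ∘ S.F l), (hE _).1⟩
  have hh : ∀ l, H.IsCellExtremal (h l) := fun l => hE _
  -- `Ψ α` plays the role of `α η`. The equations are `Ψ α ∘ F l = Ψ (r l * t l * α) + α • h l`,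
  -- with the scaling factor of the Laplacian on the cell; the iteration starts from 0.
  obtain ⟨Ψ, hΨb, hΨ⟩ := S.exists_selfSimilar_family (fun l (α : ℝ) => H.r l * t l * α)
    (fun l α => α • h l) (fun _ _ => 0) (fun α x => α * η₁ x)
    (fun α l p hp => by simp [h, hEb _ p hp]) (fun α p hp => by simp [hη₁b p hp])
    (fun _ => 0) (fun _ _ _ => rfl) (fun α => (∑ l, ‖h l‖) * |α|)
    (fun α => mul_nonneg (Finset.sum_nonneg fun _ _ => norm_nonneg _) (abs_nonneg α))
    ρ hρ0 hρ1
    (fun l α => by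
      rw [abs_mul, abs_of_pos (mul_pos (H.r_pos l) (hμ.weight_pos l)), mul_left_comm]
      exact mul_le_mul_of_nonneg_right (hρ l)
        (mul_nonneg (Finset.sum_nonneg fun _ _ => norm_nonneg _) (abs_nonneg α)))
    (fun α l z => by
      simp only [ContinuousMap.zero_apply, zero_add, zero_sub, abs_neg, ContinuousMap.smul_apply,
        smul_eq_mul, abs_mul]
      rw [mul_comm]
      refine mul_le_mul_of_nonneg_right ?_ (abs_nonneg α)
      exact ((h l).norm_coe_le_norm z).trans
        (Finset.single_le_sum (f := fun l => ‖h l‖) (fun _ _ => norm_nonneg _)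
          (Finset.mem_univ l)))
  have hV1 : ∀ α, ∀ x ∈ S.V 1, Ψ α x = (α • η₁) x := fun α x hx => by
    obtain ⟨l, z, hz, rfl⟩ := S.mem_V_succ.1 hx
    rw [V_zero] at hz
    rw [hΨ, hΨb _ z hz]
    simp [h, hEb _ z hz]
  have key : ∀ m u, H.IsSpline m u → (∀ p ∈ S.V0, u p = 0) → ∀ α : ℝ,
      S.energy H.c H.r m (Ψ α) u = -(α * ∫ z, u z ∂μ) := by
    intro m
    induction m with
    | zero =>
      intro u hu hub α
      have hu0 : u = (0 : ℝ) • u :=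
        (isSpline_zero.1 hu).eq_of_eq hne ((isSpline_zero.1 hu).smul 0) fun p hp => by
          simp [hub p hp]
      rw [hu0, energy_smul_right]
      simp
    | succ m ih =>
      intro u hu hub α
      have hcell : ∀ l, S.energy H.c H.r m (Ψ α ∘ S.F l) (u ∘ S.F l) =
          -(H.r l * t l * α * ∫ z, (u ∘ S.F l - E (u ∘ S.F l)) z ∂μ) +
            S.energy0 H.c (Ψ α ∘ S.F l) (u ∘ S.F l) := by
        intro l
        -- The part vanishing on `V0` falls to the induction hypothesis. The harmonic part
        -- contributes only level-zero energy; summed over `l` this is the level-one energy, given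
        -- by the Poisson equation for `η₁`. The integrals of the harmonic parts then cancel.
        have e1 : u ∘ S.F l = (u ∘ S.F l - E (u ∘ S.F l)) + E (u ∘ S.F l) := by simp
        have hv0 : ∀ p ∈ S.V0, (u ∘ S.F l - E (u ∘ S.F l)) p = 0 := fun p hp => by
          simp [hEb _ p hp]
        have e2 : Ψ α ∘ S.F l = Ψ (H.r l * t l * α) + α • h l := by
          funext z
          simp [hΨ]
        have e3 : S.energy H.c H.r m (Ψ α ∘ S.F l) (u ∘ S.F l - E (u ∘ S.F l)) =
            -(H.r l * t l * α * ∫ z, (u ∘ S.F l - E (u ∘ S.F l)) z ∂μ) := by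
          rw [e2, energy_add_left, energy_smul_left,
            (hh l).energy_eq, ih _ (((isSpline_succ.1 hu).2 l).sub ((hE _).isSpline m)) hv0,
            S.energy0_congr H.c (fun _ _ => rfl) (g' := 0) hv0]
          simp [energy0]
        have e4 : S.energy H.c H.r m (Ψ α ∘ S.F l) (E (u ∘ S.F l)) =
            S.energy0 H.c (Ψ α ∘ S.F l) (u ∘ S.F l) := by
          rw [energy_comm, (hE _).energy_eq, energy0_comm]
          exact S.energy0_congr H.c (fun _ _ => rfl) (hEb _)
        rw [← e3, ← e4, ← energy_add_right, ← e1]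
      have e5 : S.energy H.c H.r 1 (Ψ α) u =
          α * -∑ l, t l * ∫ z, E (u ∘ S.F l) z ∂μ := by
        rw [S.energy_congr H.c H.r 1 (hV1 α) (fun _ _ => rfl), energy_smul_left, hη₁ u hub]
        rfl
      rw [energy_succ]
      simp only [hcell, mul_add, Finset.sum_add_distrib]
      rw [← energy_one, e5, hμ.integral_eq_sum hu.1, mul_neg, ← neg_eq_iff_eq_neg, neg_add, neg_neg,
        ← Finset.sum_neg_distrib, Finset.mul_sum, Finset.mul_sum, ← Finset.sum_add_distrib]
      refine Finset.sum_congr rfl fun l _ => ?_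
      have e6 : ∫ z, (u ∘ S.F l - E (u ∘ S.F l)) z ∂μ =
          ∫ z, u (S.F l z) ∂μ - ∫ z, E (u ∘ S.F l) z ∂μ :=
        integral_sub (hμ.integrable (hu.1.comp (S.continuous_F l))) (hμ.integrable (hE _).1)
      rw [e6]
      have := (H.r_pos l).ne'
      field_simp
      ring
  refine ⟨Ψ 1, (Ψ 1).continuous, hΨb 1, fun m u hu hub => ?_⟩
  rw [key m u hu hub, one_mul]

end RegularHarmonicStructure

end Integral

theorem V_subset_of_le {K : Type*} [MetricSpace K] {N : ℕ} (S : PCFSystem K N) {m n : ℕ}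
    (h : m ≤ n) : S.V m ⊆ S.V n := by
  have step : ∀ m, S.V m ⊆ S.V (m + 1) := by
    intro m
    induction m with
    | zero =>
      intro x hx
      rw [V_zero] at hx
      exact S.boundary_subset_V 1 hx
    | succ m ih =>
      intro x hx
      obtain ⟨l, z, hz, rfl⟩ := S.mem_V_succ.1 hx
      exact S.F_mem_V_succ (ih hz) l
  exact monotone_nat_of_le_succ step h

/-! ### The Laplacian: linearity, maximum principle, scaling -/

namespace RegularHarmonicStructure

variable {K : Type*} [MetricSpace K] [CompactSpace K] [ConnectedSpace K]
  {N : ℕ} {S : PCFSystem K N} {H : S.RegularHarmonicStructure}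

theorem IsTent.graphLaplacian_comp_F (hne : S.V0.Nonempty) {m : ℕ} {x : K} {ψ : K → ℝ}
    {l : Fin N} (hx : x ∉ S.V0) (h : H.IsTent (m + 1) (S.F l x) ψ) (f : K → ℝ) :
    H.graphLaplacian (m + 1) f (S.F l x) = (H.r l)⁻¹ * H.graphLaplacian m (f ∘ S.F l) x := by
  rw [h.graphLaplacian_eq, h.comp_F.graphLaplacian_eq, energy_succ, mul_neg, neg_inj]
  refine Finset.sum_eq_single l (fun l' _ hl' => ?_) (fun h => absurd (Finset.mem_univ l) h)
  have : ψ ∘ S.F l' = (0 : ℝ) • ψ := by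
    funext z
    simp [h.comp_F_eq_zero hne hx hl' z]
  rw [this, energy_smul_right]
  ring

variable [MeasurableSpace K] {t : Fin N → ℝ} {μ : Measure K}

/-- Tents exist and are unique, so the choice of family is immaterial and Laplacians of different
functions can be combined. -/
theorem hasLaplacian_iff (hne : S.V0.Nonempty) {f g : K → ℝ} :
    H.HasLaplacian μ f g ↔ Continuous f ∧ Continuous g ∧ ∀ ε > 0, ∃ M : ℕ, ∀ m ≥ M,
      ∀ x ∈ S.V m \ S.V0, ∀ ψ, H.IsTent m x ψ →
        |(∫ z, ψ z ∂μ)⁻¹ * H.graphLaplacian m f x - g x| < ε := by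
  constructor
  · rintro ⟨hf, hg, ψ, hψ, h⟩
    refine ⟨hf, hg, fun ε hε => ?_⟩
    obtain ⟨M, hM⟩ := h ε hε
    refine ⟨M, fun m hm x hx φ hφ => ?_⟩
    rw [hφ.unique hne (hψ m x hx)]
    exact hM m hm x hx
  · rintro ⟨hf, hg, h⟩
    choose! ψ hψ using fun m x (hx : x ∈ S.V m \ S.V0) => exists_isTent (H := H) hne hx.1
    refine ⟨hf, hg, ψ, hψ, fun ε hε => ?_⟩
    obtain ⟨M, hM⟩ := h ε hε
    exact ⟨M, fun m hm x hx => hM m hm x hx _ (hψ m x hx)⟩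

theorem HasLaplacian.add (hne : S.V0.Nonempty) {f g f' g' : K → ℝ} (h : H.HasLaplacian μ f g)
    (h' : H.HasLaplacian μ f' g') : H.HasLaplacian μ (f + f') (g + g') := by
  rw [hasLaplacian_iff hne] at h h' ⊢
  refine ⟨h.1.add h'.1, h.2.1.add h'.2.1, fun ε hε => ?_⟩
  obtain ⟨M, hM⟩ := h.2.2 (ε / 2) (half_pos hε)
  obtain ⟨M', hM'⟩ := h'.2.2 (ε / 2) (half_pos hε)
  refine ⟨max M M', fun m hm x hx ψ hψ => ?_⟩
  have h1 := hM m (le_of_max_le_left hm) x hx ψ hψ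
  have h2 := hM' m (le_of_max_le_right hm) x hx ψ hψ
  rw [hψ.graphLaplacian_eq] at h1 h2 ⊢
  rw [energy_add_left, Pi.add_apply]
  rw [abs_lt] at h1 h2 ⊢
  constructor <;> linarith

theorem HasLaplacian.smul (hne : S.V0.Nonempty) {f g : K → ℝ} (h : H.HasLaplacian μ f g)
    (s : ℝ) : H.HasLaplacian μ (s • f) (s • g) := by
  rw [hasLaplacian_iff hne] at h ⊢
  refine ⟨h.1.const_smul s, h.2.1.const_smul s, fun ε hε => ?_⟩
  have hs : 0 < |s| + 1 := by positivity
  obtain ⟨M, hM⟩ := h.2.2 (ε / (|s| + 1)) (by positivity)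
  refine ⟨M, fun m hm x hx ψ hψ => ?_⟩
  have h1 := hM m hm x hx ψ hψ
  rw [lt_div_iff₀ hs] at h1
  have h2 : (∫ z, ψ z ∂μ)⁻¹ * H.graphLaplacian m (s • f) x - (s • g) x =
      s * ((∫ z, ψ z ∂μ)⁻¹ * H.graphLaplacian m f x - g x) := by
    rw [hψ.graphLaplacian_eq, hψ.graphLaplacian_eq, energy_smul_left, Pi.smul_apply, smul_eq_mul]
    ring
  rw [h2, abs_mul]
  nlinarith [abs_nonneg ((∫ z, ψ z ∂μ)⁻¹ * H.graphLaplacian m f x - g x)]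

theorem IsCellExtremal.hasLaplacian (hne : S.V0.Nonempty) {h : K → ℝ} (hh : H.IsCellExtremal h) :
    H.HasLaplacian μ h 0 := by
  rw [hasLaplacian_iff hne]
  refine ⟨hh.1, continuous_const, fun ε hε => ⟨0, fun m _ x hx ψ hψ => ?_⟩⟩
  rw [hψ.graphLaplacian_eq, hh.energy_eq, S.energy0_congr H.c (f' := h) (fun _ _ => rfl) (g' := 0)
    (hψ.eq_zero_of_mem_boundary hx.2)]
  simpa [energy0] using hε

/-- The maximum principle. -/
theorem HasLaplacian.nonpos (hne : S.V0.Nonempty) {u g : K → ℝ}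
    (h : H.HasLaplacian μ u g) {δ : ℝ} (hδ : 0 < δ) (hg : ∀ x, δ ≤ g x)
    (hu : ∀ p ∈ S.V0, u p ≤ 0) (x : K) : u x ≤ 0 := by
  rw [hasLaplacian_iff hne] at h
  obtain ⟨hc, -, h⟩ := h
  obtain ⟨M, hM⟩ := h δ hδ
  refine S.le_of_le_on_V hne hc continuous_const (fun m x hx => ?_) x
  have hx' := S.V_subset_of_le (le_max_left m M) hx
  set n := max m M with hn
  -- At an interior maximum over the finite set `V n` the graph Laplacian is nonpositive, yet by the
  -- choice of `M` its normalized value exceeds `g z - δ ≥ 0`.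
  obtain ⟨z, hz, hmax⟩ := Set.exists_max_image _ u (S.finite_V n) ⟨x, hx'⟩
  refine (hmax x hx').trans ?_
  by_cases hzB : z ∈ S.V0
  · exact hu z hzB
  exfalso
  obtain ⟨ψ, hψ⟩ := exists_isTent (H := H) hne hz
  have h1 := (abs_lt.1 (hM n (le_max_right m M) z ⟨hz, hzB⟩ ψ hψ)).1
  have h2 : H.graphLaplacian n u z ≤ 0 := by
    unfold graphLaplacian
    refine Finset.sum_nonpos fun w _ => Finset.sum_nonpos fun p hp =>
      Finset.sum_nonpos fun q hq => ?_
    split_ifs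
    · exact mul_nonpos_of_nonneg_of_nonpos
        (mul_nonneg (inv_pos.2 (wordProd_pos H.r_pos w)).le (H.c_nonneg p hp q hq))
        (sub_nonpos.2 (hmax _ (S.cellMap_mem_V w hq)))
    · exact le_rfl
  have h3 : 0 ≤ ∫ z, ψ z ∂μ := integral_nonneg (hψ.nonneg hne)
  have h4 := mul_nonpos_of_nonneg_of_nonpos (inv_nonneg.2 h3) h2
  linarith [hg z]

/-- A function vanishing at the boundary is controlled by its Laplacian. -/
theorem HasLaplacian.abs_le_mul (hne : S.V0.Nonempty) {u g η : K → ℝ} (h : H.HasLaplacian μ u g)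
    (hη : H.HasLaplacian μ η fun _ => 1) {C δ : ℝ} (hC : ∀ x, |η x| ≤ C)
    (hg : ∃ δ' < δ, ∀ x, |g x| ≤ δ')
    (hu0 : ∀ p ∈ S.V0, u p = 0) (hη0 : ∀ p ∈ S.V0, η p = 0) (x : K) : |u x| ≤ δ * C := by
  obtain ⟨δ', hδ', hg⟩ := hg
  have hδ0 : 0 ≤ δ := ((abs_nonneg _).trans (hg x)).trans hδ'.le
  -- Both `u + δ η` and `-u + δ η` have Laplacian at least `δ - δ' > 0`, so `|u| ≤ -δ η`.
  have h1 := (h.add hne (hη.smul hne δ)).nonpos hne (sub_pos.2 hδ')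
    (fun x => by
      have := (abs_le.1 (hg x)).1
      simp only [Pi.add_apply, Pi.smul_apply, smul_eq_mul]
      linarith)
    (fun p hp => by simp [hu0 p hp, hη0 p hp]) x
  have h2 := ((h.smul hne (-1)).add hne (hη.smul hne δ)).nonpos hne (sub_pos.2 hδ')
    (fun x => by
      have := (abs_le.1 (hg x)).2
      simp only [Pi.add_apply, Pi.smul_apply, smul_eq_mul]
      linarith)
    (fun p hp => by simp [hu0 p hp, hη0 p hp]) x
  simp only [Pi.add_apply, Pi.smul_apply, smul_eq_mul] at h1 h2
  have h3 := mul_le_mul_of_nonneg_left (hC x) hδ0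
  have h4 := mul_le_mul_of_nonneg_left (neg_abs_le (η x)) hδ0
  rw [abs_le]
  constructor <;> linarith

variable [BorelSpace K]

/-- The tent at `F l x` lives on one cell: its integral gains the factor `t l` and the graph
Laplacian the factor `(r l)⁻¹`. -/
theorem HasLaplacian.comp_F (hμ : S.IsSelfSimilarMeasure t μ) (hne : S.V0.Nonempty)
    {f g : K → ℝ} (h : H.HasLaplacian μ f g) (l : Fin N) :
    H.HasLaplacian μ (f ∘ S.F l) ((H.r l * t l) • (g ∘ S.F l)) := by
  rw [hasLaplacian_iff hne] at h ⊢
  refine ⟨h.1.comp (S.continuous_F l), (h.2.1.comp (S.continuous_F l)).const_smul _,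
    fun ε hε => ?_⟩
  have hrt : 0 < H.r l * t l := mul_pos (H.r_pos l) (hμ.weight_pos l)
  obtain ⟨M, hM⟩ := h.2.2 (ε / (H.r l * t l)) (div_pos hε hrt)
  refine ⟨M, fun m hm x hx ψ hψ => ?_⟩
  obtain ⟨φ, hφ⟩ := exists_isTent (H := H) hne (S.F_mem_V_succ hx.1 l)
  have h1 := hM (m + 1) (by lia) (S.F l x)
    ⟨S.F_mem_V_succ hx.1 l, S.F_notMem_boundary hx.2 l⟩ φ hφ
  rw [hφ.graphLaplacian_comp_F hne hx.2, hφ.integral_eq hμ hne hx.2,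
    show (∫ z, φ (S.F l z) ∂μ) = ∫ z, ψ z ∂μ by rw [hψ.unique hne hφ.comp_F]; rfl,
    lt_div_iff₀ hrt] at h1
  have hψ0 := (hψ.integral_pos hμ hne).ne'
  have hr := (H.r_pos l).ne'
  have ht := (hμ.weight_pos l).ne'
  have h2 : (∫ z, ψ z ∂μ)⁻¹ * H.graphLaplacian m (f ∘ S.F l) x -
      ((H.r l * t l) • (g ∘ S.F l)) x =
      ((t l * ∫ z, ψ z ∂μ)⁻¹ * ((H.r l)⁻¹ * H.graphLaplacian m (f ∘ S.F l) x) - g (S.F l x)) *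
        (H.r l * t l) := by
    simp only [Pi.smul_apply, smul_eq_mul, Function.comp_apply]
    field_simp
  rw [h2, abs_mul, abs_of_pos hrt]
  exact h1

theorem HasLaplacian.comp_cellMap (hμ : S.IsSelfSimilarMeasure t μ) (hne : S.V0.Nonempty) {m : ℕ}
    (w : Fin m → Fin N) {f g : K → ℝ} (h : H.HasLaplacian μ f g) :
    H.HasLaplacian μ (f ∘ S.cellMap w)
      ((wordProd H.r w * wordProd t w) • (g ∘ S.cellMap w)) := by
  induction m generalizing f g with
  | zero => simpa [cellMap_zero, wordProd] using h
  | succ m ih =>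
    have := ih (fun i => w i.succ) (h.comp_F hμ hne (w 0))
    rw [cellMap_succ, ← Function.comp_assoc, ← Function.comp_assoc]
    convert this using 1
    funext x
    simp only [wordProd, Fin.prod_univ_succ, Pi.smul_apply, Function.comp_apply, smul_eq_mul]
    ring

/-- Testing the weak equation with tents makes the normalized graph Laplacians equal to 1 at every
level, not only in the limit. -/
theorem exists_hasLaplacian_one (hμ : S.IsSelfSimilarMeasure t μ) (hne : S.V0.Nonempty) :
    ∃ η : K → ℝ, H.HasLaplacian μ η (fun _ => 1) ∧ ∀ p ∈ S.V0, η p = 0 := by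
  obtain ⟨η, hηc, hηb, hη⟩ := exists_weak_potential (H := H) hμ hne
  refine ⟨η, (hasLaplacian_iff hne).2 ⟨hηc, continuous_const, fun ε hε =>
    ⟨0, fun m _ x hx ψ hψ => ?_⟩⟩, hηb⟩
  rw [hψ.graphLaplacian_eq, hη m ψ (isTent_iff.1 hψ).1 (hψ.eq_zero_of_mem_boundary hx.2), neg_neg,
    inv_mul_cancel₀ (hψ.integral_pos hμ hne).ne', sub_self, abs_zero]
  exact hε

end RegularHarmonicStructure

end PCFSystem

end

/-! ### The limit formula -/

theorem theorem5p2 {K : Type*} [MetricSpace K] [CompactSpace K] [ConnectedSpace K]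
    [MeasurableSpace K] [BorelSpace K] {N : ℕ} (S : PCFSystem K N)
    (H : S.RegularHarmonicStructure) (t : Fin N → ℝ) (μ : Measure K)
    (hμ : S.IsSelfSimilarMeasure t μ)
    (n : ℕ) (y : Fin n → K) (hy : ∀ j, y j ∈ S.Vstar) (a : Fin n → ℝ) (A : ℝ) (hA : A ≠ 0)
    (hharm : ∀ h : K → ℝ, H.IsHarmonic h → ∑ j, a j * h (y j) = 0)
    (hone : ∀ h' : K → ℝ, H.HasLaplacian μ h' (fun _ => 1) → ∑ j, a j * h' (y j) = A)
    (f g : K → ℝ) (hfg : H.HasLaplacian μ f g) :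
    TendstoUniformlyOn
      (fun (m : ℕ) (p : K × (ℕ → Fin N)) =>
        A⁻¹ * (PCFSystem.wordProd H.r (PCFSystem.trunc p.2 m) *
            PCFSystem.wordProd t (PCFSystem.trunc p.2 m))⁻¹ *
          ∑ j, a j * f (S.cellMap (PCFSystem.trunc p.2 m) (y j)))
      (fun p => g p.1) atTop {p : K × (ℕ → Fin N) | S.IsAddress p.2 p.1} := by
  open PCFSystem RegularHarmonicStructure in
  rcases S.V0.eq_empty_or_nonempty with h0 | hne
  -- Without boundary points there are no vertices, so the zero function vacuously has Laplacian 1,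
  -- which would give `A = 0`.
  · exfalso
    have hV : ∀ m x, x ∉ S.V m := fun m x hx => by
      obtain ⟨w, p, hp, -⟩ := Set.mem_iUnion.1 hx
      simp [h0] at hp
    refine hA ((hone (fun _ => 0) ⟨continuous_const, continuous_const, fun _ _ _ => 0,
      fun m x hx => absurd hx.1 (hV m x),
      fun ε _ => ⟨0, fun m _ x hx => absurd hx.1 (hV m x)⟩⟩).symm.trans ?_)
    simp
  obtain ⟨η, hη, hη0⟩ := exists_hasLaplacian_one (H := H) hμ hne
  obtain ⟨C, hC⟩ : ∃ C, ∀ x, |η x| ≤ C := by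
    obtain ⟨C, hC⟩ := isCompact_univ.exists_bound_of_continuousOn hη.1.continuousOn
    exact ⟨C, fun x => hC x trivial⟩
  have hηA := hone η hη
  rw [Metric.tendstoUniformlyOn_iff]
  intro ε hε
  set D := |A|⁻¹ * ∑ j, |a j| * |C| with hD
  have hD0 : 0 ≤ D := mul_nonneg (inv_nonneg.2 (abs_nonneg _))
    (Finset.sum_nonneg fun _ _ => mul_nonneg (abs_nonneg _) (abs_nonneg _))
  -- The final error is `δ * D`; the added 1 makes it strictly less than `ε` and allows `D = 0`.
  set δ := ε / (D + 1) with hδ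
  have hδ0 : 0 < δ := by positivity
  obtain ⟨θ, hθ, hgu⟩ := Metric.uniformContinuous_iff.1
    (CompactSpace.uniformContinuous_of_continuous hfg.2.1) (δ / 2) (half_pos hδ0)
  obtain ⟨M, hM⟩ := S.exists_level_dist_lt hθ
  filter_upwards [eventually_ge_atTop M] with m hm
  rintro ⟨x, ω⟩ hx
  obtain ⟨z, hz⟩ : x ∈ Set.range (S.cellMap (trunc ω m)) := hx m
  simp only
  -- From here only `x = F_w z` matters, and `M` was chosen for all words at once; hence the
  -- uniformity in the point and its address.
  generalize trunc ω m = w at hz ⊢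
  set κ := wordProd H.r w * wordProd t w with hκ
  have hκ0 : 0 < κ := mul_pos (wordProd_pos H.r_pos w) (wordProd_pos hμ.weight_pos w)
  obtain ⟨h, hh, hhb⟩ := H.exists_isCellExtremal hne (f ∘ S.cellMap w)
  -- The remainder vanishes on `V0` and its Laplacian is `κ (g ∘ F_w - g x)`, at most `κ * (δ / 2)`
  -- in absolute value.
  have hlap := ((hfg.comp_cellMap hμ hne w).add hne ((hh.hasLaplacian hne).smul hne (-1))).add hne
    (hη.smul hne (-(κ * g x)))
  have hbound := hlap.abs_le_mul hne hη (δ := κ * δ) (C := |C|)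
    (fun x => (hC x).trans (le_abs_self C))
    ⟨κ * (δ / 2), mul_lt_mul_of_pos_left (half_lt_self hδ0) hκ0, fun v => by
      have h1 : dist (g (S.cellMap w v)) (g x) < δ / 2 := hgu (by rw [← hz]; exact hM m hm w v z)
      rw [Real.dist_eq] at h1
      have h2 : κ * g (S.cellMap w v) + -1 * 0 + -(κ * g x) * 1 = κ * (g (S.cellMap w v) - g x) := by
        ring
      change |κ * g (S.cellMap w v) + -1 * 0 + -(κ * g x) * 1| ≤ _
      rw [h2, abs_mul, abs_of_pos hκ0]
      exact mul_le_mul_of_nonneg_left h1.le hκ0.le⟩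
    (fun p hp => by simp [hhb p hp, hη0 p hp]) hη0
  set u := f ∘ S.cellMap w + (-1 : ℝ) • h + (-(κ * g x)) • η with hu
  have hsum : ∑ j, a j * u (y j) = ∑ j, a j * f (S.cellMap w (y j)) - κ * g x * A := by
    rw [← hηA, ← sub_zero (∑ j, a j * f (S.cellMap w (y j))),
      ← hharm h (isHarmonic_iff_isCellExtremal.2 hh), Finset.mul_sum, ← Finset.sum_sub_distrib,
      ← Finset.sum_sub_distrib]
    refine Finset.sum_congr rfl fun j _ => ?_
    simp only [hu, Pi.add_apply, Pi.smul_apply, smul_eq_mul, Function.comp_apply]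
    ring
  have hsumle : |∑ j, a j * u (y j)| ≤ κ * δ * ∑ j, |a j| * |C| := by
    rw [Finset.mul_sum]
    refine (Finset.abs_sum_le_sum_abs _ _).trans (Finset.sum_le_sum fun j _ => ?_)
    rw [abs_mul, mul_left_comm]
    exact mul_le_mul_of_nonneg_left (hbound (y j)) (abs_nonneg _)
  rw [dist_comm, Real.dist_eq]
  have hfin : A⁻¹ * κ⁻¹ * ∑ j, a j * f (S.cellMap w (y j)) - g x =
      A⁻¹ * κ⁻¹ * ∑ j, a j * u (y j) := by
    rw [hsum]
    field_simp
  rw [hfin, abs_mul, abs_mul, abs_inv, abs_inv, abs_of_pos hκ0]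
  calc |A|⁻¹ * κ⁻¹ * |∑ j, a j * u (y j)|
      ≤ |A|⁻¹ * κ⁻¹ * (κ * δ * ∑ j, |a j| * |C|) := by gcongr
    _ = δ * D := by
      rw [hD]
      generalize ∑ j, |a j| * |C| = R
      field_simp
    _ < ε := by
      rw [hδ, div_mul_eq_mul_div, div_lt_iff₀ (by positivity)]
      linarith
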